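/- Let $k$ be an algebraically closed field of characteristic $0$ and $\mathfrak g$ a finite dimensional simple Lie algebra over $k$ with Killing form $(\cdot|\cdot)$. Let $\sigma_1,\dots,\sigma_n$ be commuting automorphisms of $\mathfrak g$ with $\sigma_j^{m_j}=1$, $m_j\ge 1$, and let $\zeta_j\in k$ be a primitive $m_j$-th root of unity. Put $R=k[t_1^{\pm1},\dots,t_n^{\pm1}]\subseteq S=k[t_1^{\pm1/m_1},\dots,t_n^{\pm1/m_n}]$, $\mathfrak g_S=\mathfrak g\otimes_k S$, and $$L(\mathfrak g,\sigma_1,\dots,\sigma_n)=\bigoplus_{i\in\mathbb Z^n}\{x\in\mathfrak g:\sigma_j(x)=\zeta_j^{i_j}x\ \text{for all } j\}\otimes t_1^{i_1/m_1}\cdots t_n^{i_n/m_n}\subseteq\mathfrak g_S ,$$ which is naturally $\mathbb Z^n$-graded. *Descent construction.* The Galois group of $S/R$ is $G=\prod_j\mathbb Z/m_j$, with $a\in G$ acting on $S$ by $t_j^{1/m_j}\mapsto\zeta_j^{a_j}t_j^{1/m_j}$. Let $v_a=\sigma_1^{-a_1}\cdots\sigma_n^{-a_n}$ and $u_a=v_a\otimes\mathrm{id}$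 on $\mathfrak g_S$, and let $L_u=\{X\in\mathfrak g_S: u_a({}^aX)=X \text{ for all } a\in G\}$. Let $\widehat{\mathfrak g_S}=\mathfrak g_S\oplus\Omega_{S/k}/dS$ be the $k$-Lie algebra with $\Omega_{S/k}/dS$ central and $[x\otimes s,y\otimes t]=[x,y]\otimes st\oplus(x|y)\,\overline{s\,dt}$, on which $G$ acts through its action on $S$. For a lift $\hat u_a$ of $u_a$ to an automorphism of $\widehat{\mathfrak g_S}$ for each $a\in G$, let $L_{\hat u}=\{x\in\widehat{\mathfrak g_S}:\hat u_a({}^ax)=x \text{ for all } a\in G\}$. *Lie tori.* Let $\Delta$ be the set of roots of a finite irreducible crystallographic root system, not necessarily reduced, together with $0$; let $Q$ be its root lattice and $\Lambda$ an abelian group. A Lie $\Lambda$-torus of type $\Delta$ is a $Q\times\Lambda$-graded $k$-Lie algebra $L=\bigoplus L_\alpha^\lambda$ such that, with $L_\alpha=\bigoplus_\lambda L_\alpha^\lambda$ and $L^\lambda=\bigoplus_\alpha L_\alpha^\lambda$: $L_\alpha=0$ for $\alpha\notin\Delta$; $L_\alpha^0\ne0$ if $0\ne\alpha\in\Delta$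 and $\alpha/2\notin\Delta$; whenever $0\neq\alpha\in\Delta$ and $L_\alpha^\lambda\ne0$ there are $e,f$ with $L_\alpha^\lambda=ke$, $L_{-\alpha}^{-\lambda}=kf$ and $[[e,f],x]=\langle\beta,\alpha^\vee\rangle x$ for all $x\in L_\beta^\mu$, $\beta\in Q$, $\mu\in\Lambda$; $L$ is generated as a Lie algebra by the $L_\alpha$ with $0\ne\alpha\in\Delta$; and $\Lambda$ is generated by $\{\lambda: L^\lambda\ne0\}$. **Statement.** Suppose that $L(\mathfrak g,\sigma_1,\dots,\sigma_n)$ is a multiloop Lie torus, that is, for some such $\Delta$ it is a Lie $\mathbb Z^n$-torus of type $\Delta$ whose $\mathbb Z^n$-grading is the natural one. Then $L_u=L(\mathfrak g,\sigma_1,\dots,\sigma_n)$, each $u_a$ has a unique lift $\hat u_a\in\mathrm{Aut}_k(\widehat{\mathfrak g_S})$, the projection $L_{\hat u}\to L_u$ is the universal central extension of the $k$-Lie algebra $L_u$, and the map $\Omega_{R/k}/dR\to\Omega_{S/k}/dS\subseteq\widehat{\mathfrak g_S}$ induced by $R\subseteq S$ is injective with image the centre of $L_{\hat u}$. -/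

import Mathlib

universe w

open scoped TensorProduct

set_option linter.unusedSectionVars false

noncomputable section

namespace MultiloopUCE

/-! ### Central extensions -/

section CentralExtensions

variable {k L E : Type*} [CommRing k] [LieRing L] [LieAlgebra k L] [LieRing E] [LieAlgebra k E]

/-- `π : E → L` is a central extension: it is surjective and its kernel is central in `E`. -/
structure IsCentralExtension (π : E →ₗ⁅k⁆ L) : Prop where
  surjective : Function.Surjective π
  ker_le_center : π.ker ≤ LieAlgebra.center k E

/-- `π : E → L` is a universal central extension: it is an initial object in the category of
central extensions of `L`. The test objects `E'` range over all types of the universe `w`. -/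
structure IsUniversalCentralExtension (π : E →ₗ⁅k⁆ L) : Prop where
  isCentralExtension : IsCentralExtension π
  existsUnique_lift : ∀ (E' : Type w) [LieRing E'] [LieAlgebra k E'] (f : E' →ₗ⁅k⁆ L),
    IsCentralExtension f → ∃! ψ : E →ₗ⁅k⁆ E', f.comp ψ = π

/-- The subalgebra of common fixed points of a family of Lie algebra endomorphisms. -/
def fixedPoints {G : Type*} (f : G → (L →ₗ⁅k⁆ L)) : LieSubalgebra k L where
  carrier := {x | ∀ g, f g x = x}
  add_mem' {x y} hx hy g := by rw [map_add, hx g, hy g]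
  zero_mem' g := map_zero _
  smul_mem' c x hx g := by rw [map_smul, hx g]
  lie_mem' {x y} hx hy g := by rw [LieHom.map_lie, hx g, hy g]

@[simp] theorem mem_fixedPoints {G : Type*} (f : G → (L →ₗ⁅k⁆ L)) (x : L) :
    x ∈ fixedPoints f ↔ ∀ g, f g x = x := Iff.rfl

/-- The sum of a family of subspaces compatible with the bracket is closed under the bracket. -/
theorem lie_mem_iSup {I : Type*} [Add I] (p : I → Submodule k L)
    (hp : ∀ i j, ∀ x y, x ∈ p i → y ∈ p j → ⁅x, y⁆ ∈ p (i + j)) {x y : L}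
    (hx : x ∈ ⨆ i, p i) (hy : y ∈ ⨆ i, p i) : ⁅x, y⁆ ∈ ⨆ i, p i := by
  induction hx using Submodule.iSup_induction' with
  | zero => simp
  | add x x' _ _ h h' => rw [add_lie]; exact add_mem h h'
  | mem i x hx =>
    induction hy using Submodule.iSup_induction' with
    | zero => simp
    | add y y' _ _ h h' => rw [lie_add]; exact add_mem h h'
    | mem j y hy => exact Submodule.mem_iSup_of_mem (i + j) (hp i j x y hx hy)

end CentralExtensions

/-! ### Kähler differentials modulo exact forms -/

section Kaehler

variable (k A : Type*) [CommRing k] [CommRing A] [Algebra k A]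

/-- The `k`-subspace `dA` of `Ω_{A/k}`. -/
def exactForms : Submodule k (Ω[A⁄k]) :=
  LinearMap.range (KaehlerDifferential.D k A : A →ₗ[k] Ω[A⁄k])

/-- The `k`-space `Ω_A / dA`. -/
abbrev OmegaModExact : Type _ := Ω[A⁄k] ⧸ exactForms k A

/-- The pairing `(a, b) ↦ class of a db`, with values in `Ω_A / dA`. -/
def adb : A →ₗ[k] A →ₗ[k] OmegaModExact k A :=
  LinearMap.mk₂ k (fun a b => (exactForms k A).mkQ (a • KaehlerDifferential.D k A b))
    (fun a a' b => by rw [add_smul, map_add])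
    (fun c a b => by rw [smul_assoc, map_smul])
    (fun a b b' => by rw [map_add, smul_add, map_add])
    (fun c a b => by
      rw [← map_smul (exactForms k A).mkQ c, smul_comm c a, ← (KaehlerDifferential.D k A).map_smul c b])

theorem adb_apply (a b : A) :
    adb k A a b = (exactForms k A).mkQ (a • KaehlerDifferential.D k A b) := rfl

theorem adb_skew (a b : A) : adb k A a b + adb k A b a = 0 := by
  rw [adb_apply, adb_apply, ← map_add, ← Derivation.leibniz]
  exact (Submodule.Quotient.mk_eq_zero _).2 ⟨a * b, rfl⟩

theorem adb_cyclic (a b c : A) :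
    adb k A (a * b) c + adb k A (b * c) a + adb k A (c * a) b = 0 := by
  simp only [adb_apply]
  rw [← map_add, ← map_add]
  refine (Submodule.Quotient.mk_eq_zero _).2 ⟨a * b * c, ?_⟩
  change KaehlerDifferential.D k A (a * b * c) = _
  simp only [Derivation.leibniz, smul_add, smul_smul]
  rw [mul_comm c b, mul_comm c a, ← add_assoc, add_right_comm]

variable {k A} {B : Type*} [CommRing B] [Algebra k B]

/-- The `k`-linear map `Ω_A → Ω_B`, `a da' ↦ φ(a) dφ(a')` induced by `φ : A → B`. -/
def mapOmega (φ : A →ₐ[k] B) : Ω[A⁄k] →ₗ[k] Ω[B⁄k] :=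
  letI : Algebra A B := φ.toAlgebra
  haveI : IsScalarTower k A B := IsScalarTower.of_algebraMap_eq' φ.comp_algebraMap.symm
  (KaehlerDifferential.map k k A B).restrictScalars k

theorem mapOmega_smul_D (φ : A →ₐ[k] B) (a b : A) :
    mapOmega φ (a • KaehlerDifferential.D k A b) = φ a • KaehlerDifferential.D k B (φ b) := by
  let : Algebra A B := φ.toAlgebra
  have : IsScalarTower k A B := IsScalarTower.of_algebraMap_eq' φ.comp_algebraMap.symm
  change KaehlerDifferential.map k k A B (a • KaehlerDifferential.D k A b) = _
  rw [map_smul, KaehlerDifferential.map_D, algebra_compatible_smul B]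
  rfl

theorem mapOmega_D (φ : A →ₐ[k] B) (b : A) :
    mapOmega φ (KaehlerDifferential.D k A b) = KaehlerDifferential.D k B (φ b) := by
  simpa using mapOmega_smul_D φ 1 b

/-- The `k`-linear map `Ω_A / dA → Ω_B / dB` induced by `φ : A → B`. -/
def mapOmegaModExact (φ : A →ₐ[k] B) : OmegaModExact k A →ₗ[k] OmegaModExact k B :=
  Submodule.mapQ _ _ (mapOmega φ) <| by
    rintro _ ⟨a, rfl⟩
    exact ⟨φ a, (mapOmega_D φ a).symm⟩

theorem mapOmegaModExact_adb (φ : A →ₐ[k] B) (a b : A) :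
    mapOmegaModExact φ (adb k A a b) = adb k B (φ a) (φ b) := by
  rw [adb_apply, adb_apply, ← mapOmega_smul_D]
  rfl

end Kaehler

/-! ### The universal central extension of `𝔤 ⊗ S` in Kassel's model -/

section Kassel

variable (k S 𝔤 : Type*) [Field k] [CharZero k] [CommRing S] [Algebra k S]
  [LieRing 𝔤] [LieAlgebra k 𝔤]

/-- `Ω_S / dS` as a trivial module over the Lie algebra `𝔤_S = S ⊗ 𝔤`. -/
abbrev KasselCentre : Type _ := TrivialLieModule k (S ⊗[k] 𝔤) (OmegaModExact k S)

/-- The bilinear map on `𝔤_S` with `(s ⊗ x, t ⊗ y) ↦ (x | y) • class of s dt`, where `( | )` is the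
Killing form of `𝔤`. -/
def kasselForm : (S ⊗[k] 𝔤) →ₗ[k] (S ⊗[k] 𝔤) →ₗ[k] KasselCentre k S 𝔤 :=
  (TensorProduct.map₂ (adb k S) (killingForm k 𝔤)).compr₂
    ((TensorProduct.rid k (OmegaModExact k S)).trans
      (TrivialLieModule.equiv k (S ⊗[k] 𝔤) (OmegaModExact k S)).symm).toLinearMap

theorem kasselForm_tmul (s t : S) (x y : 𝔤) :
    kasselForm k S 𝔤 (s ⊗ₜ x) (t ⊗ₜ y) =
      (TrivialLieModule.equiv k (S ⊗[k] 𝔤) (OmegaModExact k S)).symm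
        (killingForm k 𝔤 x y • adb k S s t) := by
  simp [kasselForm]

theorem kasselForm_skew (X Y : S ⊗[k] 𝔤) : kasselForm k S 𝔤 X Y + kasselForm k S 𝔤 Y X = 0 := by
  induction X using TensorProduct.induction_on with
  | zero => simp
  | add X X' h h' =>
    simp only [map_add, LinearMap.add_apply]
    rw [add_add_add_comm, h, h', add_zero]
  | tmul s x =>
    induction Y using TensorProduct.induction_on with
    | zero => simp
    | add Y Y' h h' =>
      simp only [map_add, LinearMap.add_apply]
      rw [add_add_add_comm, h, h', add_zero]
    | tmul t y =>
      rw [kasselForm_tmul, kasselForm_tmul, ← map_add, LieModule.traceForm_comm k 𝔤 𝔤 y x,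
        ← smul_add, adb_skew, smul_zero, map_zero]

theorem kasselForm_self (X : S ⊗[k] 𝔤) : kasselForm k S 𝔤 X X = 0 := by
  have h := kasselForm_skew k S 𝔤 X X
  rw [← two_smul k] at h
  exact (smul_eq_zero.1 h).resolve_left two_ne_zero

theorem kasselForm_jacobi (X Y Z : S ⊗[k] 𝔤) :
    kasselForm k S 𝔤 X ⁅Y, Z⁆ = kasselForm k S 𝔤 ⁅X, Y⁆ Z + kasselForm k S 𝔤 Y ⁅X, Z⁆ := by
  induction X using TensorProduct.induction_on with
  | zero => simp
  | add X X' h h' =>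
    simp only [map_add, LinearMap.add_apply, add_lie, h, h']; abel
  | tmul s x =>
    induction Y using TensorProduct.induction_on with
    | zero => simp
    | add Y Y' h h' =>
      simp only [map_add, LinearMap.add_apply, add_lie, lie_add, h, h']; abel
    | tmul t y =>
      induction Z using TensorProduct.induction_on with
      | zero => simp
      | add Z Z' h h' =>
        simp only [map_add, lie_add, h, h']; abel
      | tmul r z =>
        simp only [LieAlgebra.ExtendScalars.bracket_tmul, kasselForm_tmul]
        rw [← map_add]
        congr 1
        have h1 : killingForm k 𝔤 x ⁅y, z⁆ = killingForm k 𝔤 ⁅x, y⁆ z :=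
          (LieModule.traceForm_apply_lie_apply k 𝔤 𝔤 x y z).symm
        have h2 : killingForm k 𝔤 y ⁅x, z⁆ = - killingForm k 𝔤 ⁅x, y⁆ z := by
          rw [← lie_skew x y, map_neg, LinearMap.neg_apply, neg_neg]
          exact (LieModule.traceForm_apply_lie_apply k 𝔤 𝔤 y x z).symm
        rw [h1, h2, neg_smul, ← sub_eq_add_neg, ← smul_sub]
        congr 1
        have e1 := adb_cyclic k S s t r
        have e2 := adb_skew k S s (t * r)
        have e3 := adb_skew k S t (s * r)
        rw [mul_comm r s] at e1
        rw [← sub_eq_zero]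
        calc _ = (adb k S s (t * r) + adb k S (t * r) s) + (adb k S t (s * r) + adb k S (s * r) t)
              - (adb k S (s * t) r + adb k S (t * r) s + adb k S (s * r) t) := by abel
          _ = 0 := by rw [e1, e2, e3, add_zero, sub_zero]

/-- Kassel's cocycle on `𝔤_S` with values in `Ω_S / dS`. -/
def kasselCocycle : LieModule.Cohomology.twoCocycle k (S ⊗[k] 𝔤) (KasselCentre k S 𝔤) :=
  ⟨⟨kasselForm k S 𝔤, kasselForm_self k S 𝔤⟩,
    (LieModule.Cohomology.mem_twoCocycle_iff_of_trivial k (S ⊗[k] 𝔤) (KasselCentre k S 𝔤) _).2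
      (kasselForm_jacobi k S 𝔤)⟩

/-- The `k`-Lie algebra `𝔤_S ⊕ Ω_S / dS` with the bracket
`[s ⊗ x, t ⊗ y] = st ⊗ [x, y] ⊕ (x | y) • class of s dt`, and with `Ω_S / dS` central. -/
abbrev Kassel : Type _ := LieAlgebra.ofTwoCocycle (kasselCocycle k S 𝔤)

variable {k S 𝔤}

/-- The element `X ⊕ z` of Kassel's Lie algebra. -/
def Kassel.mk (X : S ⊗[k] 𝔤) (z : OmegaModExact k S) : Kassel k S 𝔤 :=
  LieAlgebra.ofProd (kasselCocycle k S 𝔤)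
    (X, (TrivialLieModule.equiv k (S ⊗[k] 𝔤) (OmegaModExact k S)).symm z)

/-- The component of an element of Kassel's Lie algebra in `Ω_S / dS`. -/
def Kassel.snd (x : Kassel k S 𝔤) : OmegaModExact k S :=
  TrivialLieModule.equiv k (S ⊗[k] 𝔤) (OmegaModExact k S)
    ((LieAlgebra.ofProd (kasselCocycle k S 𝔤)).symm x).2

/-- The projection from Kassel's Lie algebra onto `𝔤_S`. -/
def Kassel.proj : Kassel k S 𝔤 →ₗ⁅k⁆ S ⊗[k] 𝔤 where
  toFun x := ((LieAlgebra.ofProd (kasselCocycle k S 𝔤)).symm x).1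
  map_add' _ _ := by simp
  map_smul' _ _ := by simp
  map_lie' {_ _} := by simp [LieAlgebra.bracket_ofTwoCocycle]

@[simp] theorem Kassel.proj_mk (X : S ⊗[k] 𝔤) (z : OmegaModExact k S) :
    Kassel.proj (Kassel.mk X z) = X := rfl

@[simp] theorem Kassel.snd_mk (X : S ⊗[k] 𝔤) (z : OmegaModExact k S) :
    Kassel.snd (Kassel.mk X z) = z := rfl

theorem Kassel.lie_mk (X Y : S ⊗[k] 𝔤) (z w : OmegaModExact k S) :
    ⁅Kassel.mk X z, Kassel.mk Y w⁆ = Kassel.mk ⁅X, Y⁆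
      (TrivialLieModule.equiv k (S ⊗[k] 𝔤) (OmegaModExact k S) (kasselForm k S 𝔤 X Y)) := by
  simp only [LieAlgebra.bracket_ofTwoCocycle, Kassel.mk, Equiv.symm_apply_apply, trivial_lie_zero,
    add_zero, sub_zero]
  rfl

end Kassel

/-! ### Descent -/

section Descent

variable {k S 𝔤 G : Type*} [Field k] [CharZero k] [CommRing S] [Algebra k S]
  [LieRing 𝔤] [LieAlgebra k 𝔤]

/-- The action `1 ⊗ φ` on `𝔤_S` of an automorphism `φ` of `S`. -/
def galLoop (φ : S →ₐ[k] S) : S ⊗[k] 𝔤 →ₗ⁅k⁆ S ⊗[k] 𝔤 :=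
  LieAlgebra.ExtendScalars.map φ LieHom.id

/-- The `S`-linear map `v ⊗ id` on `𝔤_S`, for `v` an automorphism of `𝔤`. -/
def constLoop (v : 𝔤 →ₗ⁅k⁆ 𝔤) : S ⊗[k] 𝔤 →ₗ⁅k⁆ S ⊗[k] 𝔤 :=
  LieAlgebra.ExtendScalars.map (AlgHom.id k S) v

@[simp] theorem galLoop_tmul (φ : S →ₐ[k] S) (s : S) (x : 𝔤) :
    galLoop φ (s ⊗ₜ[k] x) = φ s ⊗ₜ x := rfl

@[simp] theorem constLoop_tmul (v : 𝔤 →ₗ⁅k⁆ 𝔤) (s : S) (x : 𝔤) :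
    constLoop v (s ⊗ₜ[k] x) = s ⊗ₜ v x := rfl

theorem kasselForm_galLoop (φ : S →ₐ[k] S) (X Y : S ⊗[k] 𝔤) :
    TrivialLieModule.equiv k (S ⊗[k] 𝔤) (OmegaModExact k S)
        (kasselForm k S 𝔤 (galLoop φ X) (galLoop φ Y)) =
      mapOmegaModExact φ (TrivialLieModule.equiv k (S ⊗[k] 𝔤) (OmegaModExact k S)
        (kasselForm k S 𝔤 X Y)) := by
  induction X using TensorProduct.induction_on with
  | zero => simp
  | add X X' h h' => simp only [map_add, LinearMap.add_apply, h, h']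
  | tmul s x =>
    induction Y using TensorProduct.induction_on with
    | zero => simp
    | add Y Y' h h' => simp only [map_add, h, h']
    | tmul t y =>
      rw [galLoop_tmul, galLoop_tmul, kasselForm_tmul, kasselForm_tmul,
        LinearEquiv.apply_symm_apply, LinearEquiv.apply_symm_apply, map_smul,
        mapOmegaModExact_adb]

/-- The action on Kassel's Lie algebra `𝔤_S ⊕ Ω_S / dS` of an automorphism `φ` of `S`:
`(s ⊗ x) ⊕ z ↦ (φ(s) ⊗ x) ⊕ φ(z)`. -/
def galKassel (φ : S →ₐ[k] S) : Kassel k S 𝔤 →ₗ⁅k⁆ Kassel k S 𝔤 where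
  toFun x := Kassel.mk (galLoop φ (Kassel.proj x)) (mapOmegaModExact φ (Kassel.snd x))
  map_add' x y := by
    simp only [Kassel.mk, Kassel.snd, LieAlgebra.of_symm_add, Prod.snd_add, map_add,
      ← LieAlgebra.of_add, Prod.mk_add_mk]
  map_smul' c x := by
    simp only [Kassel.mk, Kassel.snd, LieAlgebra.of_symm_smul, Prod.smul_snd, map_smul,
      ← LieAlgebra.of_smul, Prod.smul_mk, RingHom.id_apply]
  map_lie' {x y} := by
    change Kassel.mk _ _ = ⁅Kassel.mk _ _, Kassel.mk _ _⁆
    rw [Kassel.lie_mk, kasselForm_galLoop, LieHom.map_lie, LieHom.map_lie]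
    congr 2
    simp only [Kassel.snd, LieAlgebra.bracket_ofTwoCocycle, trivial_lie_zero, add_zero, sub_zero]
    rfl

@[simp] theorem proj_galKassel (φ : S →ₐ[k] S) (x : Kassel k S 𝔤) :
    Kassel.proj (galKassel φ x) = galLoop φ (Kassel.proj x) := rfl

/-- The descended algebra `L_u = {X ∈ 𝔤_S : u_g (^g X) = X for all g}` of the constant cocycle
`u_g = v_g ⊗ id`; the group `G` acts on `S` through `ρ`. -/
def descended (ρ : G → (S →ₐ[k] S)) (v : G → (𝔤 →ₗ⁅k⁆ 𝔤)) : LieSubalgebra k (S ⊗[k] 𝔤) :=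
  fixedPoints fun g => (constLoop (v g)).comp (galLoop (ρ g))

/-- The automorphism `θ'` of Kassel's Lie algebra is a lift of the endomorphism `θ` of `𝔤_S`. -/
def IsLift (θ : S ⊗[k] 𝔤 →ₗ⁅k⁆ S ⊗[k] 𝔤) (θ' : Kassel k S 𝔤 ≃ₗ⁅k⁆ Kassel k S 𝔤) : Prop :=
  ∀ x, Kassel.proj (θ' x) = θ (Kassel.proj x)

/-- The descent construction `L_û = {x ∈ 𝔤_S ⊕ Ω_S / dS : û_g (^g x) = x for all g}`. -/
def descendedHat (ρ : G → (S →ₐ[k] S)) (uhat : G → (Kassel k S 𝔤 ≃ₗ⁅k⁆ Kassel k S 𝔤)) :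
    LieSubalgebra k (Kassel k S 𝔤) :=
  fixedPoints fun g => (uhat g).toLieHom.comp (galKassel (ρ g))

/-- The restriction `L_û → L_u` of the projection, for `û_g` a lift of `u_g = v_g ⊗ id`. -/
def descendedProj (ρ : G → (S →ₐ[k] S)) (v : G → (𝔤 →ₗ⁅k⁆ 𝔤))
    (uhat : G → (Kassel k S 𝔤 ≃ₗ⁅k⁆ Kassel k S 𝔤))
    (h : ∀ g, IsLift (constLoop (v g)) (uhat g)) :
    descendedHat ρ uhat →ₗ⁅k⁆ descended ρ v where
  toFun x := ⟨Kassel.proj (x : Kassel k S 𝔤), fun g => by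
    have hx : uhat g (galKassel (ρ g) (x : Kassel k S 𝔤)) = x := x.2 g
    change constLoop (v g) (galLoop (ρ g) (Kassel.proj (x : Kassel k S 𝔤))) = _
    rw [← proj_galKassel, ← h g, hx]⟩
  map_add' _ _ := Subtype.ext (map_add _ _ _)
  map_smul' _ _ := Subtype.ext (map_smul _ _ _)
  map_lie' {_ _} := Subtype.ext (LieHom.map_lie _ _ _)

end Descent

/-! ### Multiloop Lie algebras -/

section Multiloop

variable (k : Type*) [Field k] {n : ℕ}

/-- The algebra of Laurent polynomials in `n` variables over `k`. -/
abbrev Laurent (n : ℕ) : Type _ := AddMonoidAlgebra k (Fin n → ℤ)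

/-- The inclusion of `R = k[t₁^{±1}, …, t_n^{±1}]` into `S = k[z₁^{±1}, …, z_n^{±1}]`, where
`z_j = t_j^{1/m_j}`: it sends `t_j` to `z_j^{m_j}`. -/
def laurentIncl (m : Fin n → ℕ) : Laurent k n →ₐ[k] Laurent k n :=
  AddMonoidAlgebra.mapDomainAlgHom k k
    ({ toFun := fun i j => (m j : ℤ) * i j
       map_zero' := by ext; simp
       map_add' := fun _ _ => by ext; simp [mul_add] } : (Fin n → ℤ) →+ (Fin n → ℤ))

variable {k}

/-- The scalar `∏_j ζ_j^{a_j i_j}` by which `a ∈ ∏_j ℤ/m_j` acts on `z^i`. -/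
def galScalar {m : Fin n → ℕ} (ζ : Fin n → kˣ) (a : ∀ j, ZMod (m j)) (i : Fin n → ℤ) : kˣ :=
  ∏ j, (ζ j ^ (a j).val) ^ i j

/-- The action on `S = k[z₁^{±1}, …, z_n^{±1}]` of the element `a` of the Galois group
`G = ∏_j ℤ/m_j` of `S/R`, namely `z_j ↦ ζ_j^{a_j} z_j`; here `ζ_j` is a primitive `m_j`-th root
of unity. -/
def galLaurent {m : Fin n → ℕ} (ζ : Fin n → kˣ) (a : ∀ j, ZMod (m j)) :
    Laurent k n →ₐ[k] Laurent k n :=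
  AddMonoidAlgebra.lift k (Laurent k n) (Fin n → ℤ)
    { toFun := fun i => AddMonoidAlgebra.single i.toAdd (galScalar ζ a i.toAdd : k)
      map_one' := by simp [galScalar, AddMonoidAlgebra.one_def]
      map_mul' := fun i i' => by
        simp [galScalar, AddMonoidAlgebra.single_mul_single, zpow_add, Finset.prod_mul_distrib] }

variable {𝔤 : Type*} [LieRing 𝔤] [LieAlgebra k 𝔤]

/-- The `r`-fold iterate of a Lie algebra endomorphism. -/
def lieIterate (f : 𝔤 →ₗ⁅k⁆ 𝔤) : ℕ → (𝔤 →ₗ⁅k⁆ 𝔤)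
  | 0 => LieHom.id
  | r + 1 => f.comp (lieIterate f r)

/-- The automorphism `v_a = σ₁^{-a₁} ⋯ σ_n^{-a_n}` of `𝔤`, for `a ∈ ∏_j ℤ/m_j`. -/
def multiloopTwist {m : Fin n → ℕ} (σ : Fin n → (𝔤 ≃ₗ⁅k⁆ 𝔤)) (a : ∀ j, ZMod (m j)) : 𝔤 →ₗ⁅k⁆ 𝔤 :=
  (List.finRange n).foldr (fun j f => (lieIterate (σ j).symm.toLieHom (a j).val).comp f) LieHom.id

/-- The simultaneous eigenspace `{x : σ_j x = ζ_j^{i_j} x for all j}`. -/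
def simulEigenspace (σ : Fin n → (𝔤 ≃ₗ⁅k⁆ 𝔤)) (ζ : Fin n → kˣ) (i : Fin n → ℤ) :
    Submodule k 𝔤 where
  carrier := {x | ∀ j, σ j x = ((ζ j ^ i j : kˣ) : k) • x}
  add_mem' {x y} hx hy j := by rw [map_add, hx j, hy j, smul_add]
  zero_mem' j := by simp
  smul_mem' c x hx j := by rw [map_smul, hx j, smul_comm]

/-- The monomial map `x ↦ z^i ⊗ x`. -/
def monomialLoop (𝔤 : Type*) [LieRing 𝔤] [LieAlgebra k 𝔤] (i : Fin n → ℤ) :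
    𝔤 →ₗ[k] Laurent k n ⊗[k] 𝔤 :=
  TensorProduct.mk k (Laurent k n) 𝔤 (AddMonoidAlgebra.single i 1)

/-- The multiloop Lie algebra
`L(𝔤, σ₁, …, σ_n) = ⨁_{i ∈ ℤⁿ} 𝔤_{ī} ⊗ z^i ⊆ 𝔤_S`, where `z^i = t₁^{i₁/m₁} ⋯ t_n^{i_n/m_n}` and
`ζ_j` is a primitive `m_j`-th root of unity. -/
def multiloop (σ : Fin n → (𝔤 ≃ₗ⁅k⁆ 𝔤)) (ζ : Fin n → kˣ) :
    LieSubalgebra k (Laurent k n ⊗[k] 𝔤) where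
  toSubmodule := ⨆ i : Fin n → ℤ, (simulEigenspace σ ζ i).map (monomialLoop 𝔤 i)
  lie_mem' {X Y} hX hY := by
    refine lie_mem_iSup _ ?_ hX hY
    rintro i i' _ _ ⟨x, hx, rfl⟩ ⟨y, hy, rfl⟩
    refine ⟨⁅x, y⁆, fun j => ?_, ?_⟩
    · rw [LieEquiv.map_lie, hx j, hy j, smul_lie, lie_smul, smul_smul, Pi.add_apply, zpow_add,
        Units.val_mul]
    · simp [monomialLoop, AddMonoidAlgebra.single_mul_single]

/-- The homogeneous component of degree `i` of the natural `ℤⁿ`-grading of the multiloop Lie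
algebra: the elements of the form `z^i ⊗ x`. -/
def multiloopGrade (σ : Fin n → (𝔤 ≃ₗ⁅k⁆ 𝔤)) (ζ : Fin n → kˣ) (i : Fin n → ℤ) :
    Submodule k (multiloop σ ζ) :=
  (LinearMap.range (monomialLoop 𝔤 i)).comap (multiloop σ ζ).toSubmodule.subtype

end Multiloop

/-! ### Lie tori -/

section LieTorus

variable {k ι M N Λ L : Type*} [Field k] [AddCommGroup M] [Module k M] [AddCommGroup N]
  [Module k N] [AddCommGroup Λ] [LieRing L] [LieAlgebra k L]

/-- The family `gr α lam = L_α^lam` is the grading of a Lie `Λ`-torus `L` of type `Δ`, where `Δ` is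
the root system `P` (not necessarily reduced) together with `0`. The grading by the root lattice is
indexed by the whole root space `M`, which makes no difference because of `eq_bot_of_not_root`. -/
structure IsLieTorus (P : RootPairing ι k M N) (gr : M → Λ → Submodule k L) : Prop where
  /-- `L` is the sum of the `L_α^lam`. -/
  iSup_eq_top : ⨆ p : M × Λ, gr p.1 p.2 = ⊤
  /-- The sum of the `L_α^lam` is direct. -/
  independent : iSupIndep fun p : M × Λ => gr p.1 p.2
  /-- The grading is compatible with the bracket. -/
  lie_mem : ∀ {α β : M} {lam mu : Λ} {x y : L}, x ∈ gr α lam → y ∈ gr β mu →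
    ⁅x, y⁆ ∈ gr (α + β) (lam + mu)
  /-- `L_α = 0` unless `α ∈ Δ`. -/
  eq_bot_of_not_root : ∀ (α : M) (lam : Λ), α ≠ 0 → α ∉ Set.range P.root → gr α lam = ⊥
  /-- `L_α^0 ≠ 0` for each nonzero root `α` such that `α / 2` is not a root. -/
  ne_bot_of_indivisible : ∀ i : ι, (∀ j : ι, P.root i ≠ 2 • P.root j) → gr (P.root i) 0 ≠ ⊥
  /-- A nonzero `L_α^lam` with `α ≠ 0` is spanned by some `e`, and `L_{-α}^{-lam}` by some `f`, such
  that `[[e, f], x] = ⟨β, α^∨⟩ x` for all `x ∈ L_β^mu`. -/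
  exists_sl_two : ∀ (i : ι) (lam : Λ), gr (P.root i) lam ≠ ⊥ →
    ∃ e f : L, gr (P.root i) lam = k ∙ e ∧ gr (-P.root i) (-lam) = k ∙ f ∧
      ∀ (β : M) (mu : Λ), ∀ x ∈ gr β mu, ⁅⁅e, f⁆, x⁆ = P.coroot' i β • x
  /-- `L` is generated as a Lie algebra by the `L_α` with `α ≠ 0`. -/
  lieSpan_eq_top :
    LieSubalgebra.lieSpan k L (⋃ (i : ι) (lam : Λ), (gr (P.root i) lam : Set L)) = ⊤
  /-- The group `Λ` is generated by the `lam` with `L^lam ≠ 0`. -/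
  closure_support_eq_top : AddSubgroup.closure {lam : Λ | ∃ α, gr α lam ≠ ⊥} = ⊤

end LieTorus

end MultiloopUCE

end

/-!
The proof computes all `2`-cocycles of the multiloop algebra `L = ⨁ z^i ⊗ 𝔤_i`, and shows that they
are the ones which Kassel's cocycle on `𝔤_S` accounts for.

A central extension `E → L` with `E` perfect is universal as soon as each scalar-valued `2`-cocycle
of `L` becomes a coboundary on `E` (`isUniversalCentralExtension_of_forall_cocycle`). Three facts
are therefore needed: a description of `L_û`, its perfectness, and a determination of the cocycles
of `L`.

*Description of `L_û`.* Comparing coefficients of monomials, `X ∈ 𝔤_S` is fixed by the twisted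
Galois action exactly if its coefficients are simultaneous eigenvectors of the right weights, so
`L_u = L` (`descended_eq_multiloop`). As `v_a` preserves the Killing form, `(v_a ⊗ id) ⊕ id` is a
lift of `u_a`; it is the only one since Kassel's algebra is perfect and two lifts differ by central
elements (`isPerfect_kassel`, `IsLift.unique`). Hence `L_û = L ⊕ (Ω_S / dS)^G`. Averaging over the
Galois group kills the differentials whose degree is not in the lattice of `R`, so the invariants
are the image of `Ω_R / dR` (`exists_mapOmegaModExact_laurentIncl_eq`, `mem_descendedHat_iff`).
Since `Ω_S` is free over `S` on the `dlog z_j`, with Euler derivations as coordinates, restricting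
to monomials of `R` shows that `Ω_R / dR → Ω_S / dS` is injective
(`mapOmegaModExact_laurentIncl_injective`). The centre of `L` being trivial, `Ω_R / dR` is the
whole centre of `L_û` (`exists_equiv_center_descendedHat`).

*Perfectness of `L_û`.* If `x` and `y` have opposite degrees and `(x|y) ≠ 0`, then suitable
brackets of `z^i r ⊗ x` with `z^{-i} r' ⊗ y` have equal components in `𝔤_S` and differ by the
central element `(x|y) r dr'` (`isPerfect_descendedHat`).

*Cocycles of `L`.* In a fixed total degree `μ`, the nondegenerate Killing form turns a cocycle
into a derivation `z^λ ⊗ x ↦ z^{λ-μ} ⊗ D_λ x`. Along the degrees of `R` the maps `D_λ` change by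
scalars, because the centroid of the simple algebra `𝔤` is `k` (`exists_scalar_of_derivation`).
Subtracting a degree derivation makes `D_λ` depend only on the class of `λ`, and it is then a
derivation of `𝔤`, hence inner (`exists_inner_add_degree`). So the cocycle has the form
`(w_μ | [x, y]) + θ_μ(λ) (x | y)` with `θ_μ` additive, and skew-symmetry gives `θ_μ(μ) = 0`
(`exists_of_graded_cocycle`). The first term is a coboundary on `L`. The second is the composite of
Kassel's cocycle with a functional on `Ω_S / dS`: the condition `θ_μ(μ) = 0` says precisely that the
functional kills `d z^μ` (`exists_functional_omegaModExact`). Thus every cocycle becomes a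
coboundary on `L_û` (`exists_functional_of_cocycle`).
-/

noncomputable section

namespace MultiloopUCE

/-! ### A criterion for universality -/

section Universality

variable {k L E : Type*} [Field k] [LieRing L] [LieAlgebra k L] [LieRing E] [LieAlgebra k E]

variable (k E) in
/-- The Lie algebra `E` is spanned by its brackets. -/
def IsPerfect : Prop :=
  ∀ x : E, x ∈ Submodule.span k (Set.range fun p : E × E => ⁅p.1, p.2⁆)

/-- Two lifts of the same homomorphism along a map with central kernel agree on a perfect
algebra. -/
theorem IsPerfect.eq_of_sub_mem_center {E' : Type*} [LieRing E'] [LieAlgebra k E']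
    (hE : IsPerfect k E) (φ ψ : E →ₗ⁅k⁆ E')
    (h : ∀ x, φ x - ψ x ∈ LieAlgebra.center k E') : φ = ψ := by
  ext x
  induction hE x using Submodule.span_induction with
  | mem _ hx =>
    obtain ⟨⟨y, z⟩, rfl⟩ := hx
    have h1 (a b : E') (hb : b ∈ LieAlgebra.center k E') : ⁅a, b⁆ = 0 :=
      (LieModule.mem_maxTrivSubmodule k E' E' b).1 hb a
    have h2 : ⁅φ y, φ z⁆ - ⁅ψ y, ψ z⁆ = ⁅φ y, φ z - ψ z⁆ - ⁅ψ z, φ y - ψ y⁆ := by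
      rw [lie_sub, lie_sub, ← lie_skew (φ y) (ψ z), ← lie_skew (ψ y) (ψ z)]
      abel
    rw [h1 _ _ (h z), h1 _ _ (h y), sub_zero, sub_eq_zero] at h2
    simpa only [LieHom.map_lie] using h2
  | zero => simp
  | add x y _ _ hx hy => rw [map_add, map_add, hx, hy]
  | smul c x _ hx => rw [map_smul, map_smul, hx]

theorem isPerfect_of_le_span (H : LieSubalgebra k L)
    (h : ∀ x ∈ H, x ∈ Submodule.span k {z | ∃ x ∈ H, ∃ y ∈ H, ⁅x, y⁆ = z}) : IsPerfect k H := by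
  intro x
  have hx : (x : L) ∈ (Submodule.span k (Set.range fun p : H × H => ⁅p.1, p.2⁆)).map
      (H.toSubmodule.subtype) := by
    rw [Submodule.map_span]
    refine Submodule.span_mono ?_ (h x x.2)
    rintro _ ⟨y, hy, z, hz, rfl⟩
    exact ⟨_, ⟨(⟨y, hy⟩, ⟨z, hz⟩), rfl⟩, rfl⟩
  obtain ⟨y, hy, hyx⟩ := hx
  rwa [← Subtype.ext hyx]

/-- A central extension `π : E → L` of vector spaces with `E` perfect is universal as soon as every
scalar-valued `2`-cocycle of `L` becomes a coboundary on `E`.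

A `2`-cocycle with values in an arbitrary `V` then becomes a coboundary too: a sum of brackets
`∑ [xᵢ, yᵢ] = 0` in `E` forces `∑ ψ (π xᵢ, π yᵢ) = 0`, because every functional on `V` kills it. -/
theorem isUniversalCentralExtension_of_forall_cocycle {π : E →ₗ⁅k⁆ L}
    (hπ : IsCentralExtension π) (hE : IsPerfect k E)
    (H : ∀ ψ : L →ₗ[k] L →ₗ[k] k, (∀ x, ψ x x = 0) →
      (∀ x y z, ψ x ⁅y, z⁆ = ψ ⁅x, y⁆ z + ψ y ⁅x, z⁆) →
      ∃ F : E →ₗ[k] k, ∀ x y, F ⁅x, y⁆ = ψ (π x) (π y)) :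
    IsUniversalCentralExtension.{w} π := by
  refine ⟨hπ, fun E' _ _ f hf => ?_⟩
  have hcen (a b : E') (hb : f b = 0) : ⁅a, b⁆ = 0 :=
    (LieModule.mem_maxTrivSubmodule k E' E' b).1 (hf.ker_le_center (LieHom.mem_ker.2 hb)) a
  have hcen' (a b : E') (hb : f b = 0) : ⁅b, a⁆ = 0 := by
    rw [← lie_skew, hcen a b hb, neg_zero]
  obtain ⟨s, hs⟩ := (f : E' →ₗ[k] L).exists_rightInverse_of_surjective
    (LinearMap.range_eq_top.2 hf.surjective)
  have hfs (x : L) : f (s x) = x := LinearMap.congr_fun hs x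
  -- the cocycle of the section `s`
  let Ψ : L →ₗ[k] L →ₗ[k] E' :=
    LinearMap.mk₂ k (fun x y => ⁅s x, s y⁆ - s ⁅x, y⁆)
      (fun x x' y => by simp only [map_add, add_lie]; abel)
      (fun c x y => by simp only [map_smul, smul_lie, smul_sub])
      (fun x y y' => by simp only [map_add, lie_add]; abel)
      (fun c x y => by simp only [map_smul, lie_smul, smul_sub])
  have hΨ (x y : L) : Ψ x y = ⁅s x, s y⁆ - s ⁅x, y⁆ := rfl
  have hfΨ (x y : L) : f (Ψ x y) = 0 := by rw [hΨ, map_sub, LieHom.map_lie, hfs, hfs, hfs, sub_self]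
  have hΨself (x : L) : Ψ x x = 0 := by simp [hΨ]
  have hΨjac (x y z : L) : Ψ x ⁅y, z⁆ = Ψ ⁅x, y⁆ z + Ψ y ⁅x, z⁆ := by
    have key (x y z : L) : ⁅s x, s ⁅y, z⁆⁆ = ⁅s x, ⁅s y, s z⁆⁆ := by
      rw [← sub_eq_zero, ← lie_sub]
      refine hcen _ _ ?_
      rw [map_sub, LieHom.map_lie, hfs, hfs, hfs, sub_self]
    have key' : ⁅s ⁅x, y⁆, s z⁆ = ⁅⁅s x, s y⁆, s z⁆ := by
      rw [← lie_skew, key, lie_skew]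
    rw [hΨ, hΨ, hΨ, key, key, key', leibniz_lie (s x), leibniz_lie x, map_add]
    abel
  let b : E ⊗[k] E →ₗ[k] E := TensorProduct.lift (LieModule.toEnd k E E : E →ₗ[k] E →ₗ[k] E)
  have hb (x y : E) : b (x ⊗ₜ y) = ⁅x, y⁆ := by
    simp only [b, TensorProduct.lift.tmul]
    rfl
  let c : E ⊗[k] E →ₗ[k] E' := TensorProduct.lift
    (((LieModule.toEnd k E' E' : E' →ₗ[k] E' →ₗ[k] E').compl₁₂ s s).compl₁₂
      (π : E →ₗ[k] L) (π : E →ₗ[k] L))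
  have hc (x y : E) : c (x ⊗ₜ y) = ⁅s (π x), s (π y)⁆ := by
    simp only [c, TensorProduct.lift.tmul]
    rfl
  have hbsurj : Function.Surjective b := by
    rw [← LinearMap.range_eq_top, eq_top_iff]
    intro x _
    refine Submodule.span_le.2 ?_ (hE x)
    rintro _ ⟨⟨y, z⟩, rfl⟩
    exact ⟨y ⊗ₜ z, hb y z⟩
  have hker : LinearMap.ker b ≤ LinearMap.ker c := by
    intro T hT
    rw [LinearMap.mem_ker] at hT ⊢
    have hcT (T : E ⊗[k] E) :
        c T = TensorProduct.lift (Ψ.compl₁₂ (π : E →ₗ[k] L) (π : E →ₗ[k] L)) T + s (π (b T)) := by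
      induction T using TensorProduct.induction_on with
      | zero => simp
      | add T T' h h' => simp only [map_add, h, h']; abel
      | tmul x y => rw [hc, hb, LieHom.map_lie]; simp [hΨ]
    rw [hcT, hT, map_zero, map_zero, add_zero, ← Module.forall_dual_apply_eq_zero_iff k]
    intro ℓ
    obtain ⟨F, hF⟩ := H (Ψ.compr₂ ℓ) (fun x => by simp [hΨself])
      (fun x y z => by
        simp only [LinearMap.compr₂_apply]
        rw [hΨjac, map_add])
    have hFT (T : E ⊗[k] E) :
        ℓ (TensorProduct.lift (Ψ.compl₁₂ (π : E →ₗ[k] L) (π : E →ₗ[k] L)) T) = F (b T) := by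
      induction T using TensorProduct.induction_on with
      | zero => simp
      | add T T' h h' => simp only [map_add, h, h']
      | tmul x y => rw [hb, hF]; simp
    rw [hFT, hT, map_zero]
  obtain ⟨r, hr⟩ := b.exists_rightInverse_of_surjective (LinearMap.range_eq_top.2 hbsurj)
  have hbr (x : E) : b (r x) = x := LinearMap.congr_fun hr x
  have hτ (x y : E) : c (r ⁅x, y⁆) = ⁅s (π x), s (π y)⁆ := by
    rw [← hc, ← sub_eq_zero, ← map_sub]
    exact hker (by rw [LinearMap.mem_ker, map_sub, hbr, hb, sub_self])
  have hfτ (x : E) : f (c (r x)) = π x := by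
    induction hE x using Submodule.span_induction with
    | mem _ hx =>
      obtain ⟨⟨y, z⟩, rfl⟩ := hx
      rw [hτ, LieHom.map_lie, hfs, hfs, LieHom.map_lie]
    | zero => simp
    | add x y _ _ hx hy => simp only [map_add, hx, hy]
    | smul c x _ hx => simp only [map_smul, hx]
  let τ : E →ₗ⁅k⁆ E' :=
    { c ∘ₗ r with
      map_lie' := fun {x y} => by
        change c (r ⁅x, y⁆) = ⁅c (r x), c (r y)⁆
        have h (x : E) : f (c (r x) - s (π x)) = 0 := by rw [map_sub, hfτ, hfs, sub_self]
        have h1 := hcen' (c (r y)) _ (h x)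
        have h2 := hcen (s (π x)) _ (h y)
        rw [sub_lie, sub_eq_zero] at h1
        rw [lie_sub, sub_eq_zero] at h2
        rw [hτ, h1, h2] }
  refine ⟨τ, LieHom.ext hfτ, fun τ' hτ' => hE.eq_of_sub_mem_center _ _ fun x => ?_⟩
  refine hf.ker_le_center (LieHom.mem_ker.2 ?_)
  have h1 : f (τ' x) = π x := LieHom.congr_fun hτ' x
  have h2 : f (τ x) = π x := hfτ x
  rw [map_sub, h1, h2, sub_self]

end Universality

/-! ### Derivations and cocycles of a loop algebra over a graded simple Lie algebra -/

section Graded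

variable {k 𝔤 A : Type*} [Field k] [LieRing 𝔤] [LieAlgebra k 𝔤] [AddCommGroup A] [DecidableEq A]
  (E : A → Submodule k 𝔤) [GradedLieAlgebra E]

/-- The projection of a graded Lie algebra onto its component of degree `a`. -/
def gradedProj (a : A) : 𝔤 →ₗ[k] 𝔤 :=
  (E a).subtype ∘ₗ DirectSum.component k A (fun a => E a) a ∘ₗ
    (DirectSum.decomposeLinearEquiv E).toLinearMap

theorem gradedProj_mem (a : A) (x : 𝔤) : gradedProj E a x ∈ E a :=
  (DirectSum.decompose E x a).2

variable {E}

theorem gradedProj_of_mem {a : A} {x : 𝔤} (hx : x ∈ E a) : gradedProj E a x = x :=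
  DirectSum.decompose_of_mem_same E hx

theorem gradedProj_of_mem_ne {a b : A} {x : 𝔤} (hx : x ∈ E a) (h : a ≠ b) :
    gradedProj E b x = 0 :=
  DirectSum.decompose_of_mem_ne E hx h

theorem lie_mem_graded {a b : A} {x y : 𝔤}
    (hx : x ∈ E a) (hy : y ∈ E b) : ⁅x, y⁆ ∈ E (a + b) :=
  SetLike.GradedBracket.bracket_mem hx hy

variable (E) in
theorem graded_induction {p : 𝔤 → Prop} (zero : p 0) (mem : ∀ a, ∀ x ∈ E a, p x)
    (add : ∀ x y, p x → p y → p (x + y)) (x : 𝔤) : p x :=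
  DirectSum.Decomposition.inductionOn E zero (fun m => mem _ _ m.2) add x

theorem gradedProj_lie {a b : A} {y : 𝔤} (hy : y ∈ E b) (z : 𝔤) :
    gradedProj E (b + a) ⁅y, z⁆ = ⁅y, gradedProj E a z⁆ := by
  induction z using graded_induction E with
  | zero => simp
  | add z z' h h' => simp only [lie_add, map_add, h, h']
  | mem c z hz =>
    by_cases h : c = a
    · subst h
      rw [gradedProj_of_mem hz, gradedProj_of_mem (lie_mem_graded hy hz)]
    · rw [gradedProj_of_mem_ne hz h, lie_zero,
        gradedProj_of_mem_ne (lie_mem_graded hy hz) (by simpa using h)]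

variable (E) in
/-- The linear map which acts on the component of degree `a` as `F a`. -/
def gradedGlue (F : A → 𝔤 →ₗ[k] 𝔤) : 𝔤 →ₗ[k] 𝔤 :=
  DirectSum.toModule k A 𝔤 (fun a => F a ∘ₗ (E a).subtype) ∘ₗ
    (DirectSum.decomposeLinearEquiv E).toLinearMap

theorem gradedGlue_of_mem (F : A → 𝔤 →ₗ[k] 𝔤) {a : A} {x : 𝔤} (hx : x ∈ E a) :
    gradedGlue E F x = F a x := by
  change DirectSum.toModule k A 𝔤 _ (DirectSum.decompose E x) = _
  rw [DirectSum.decompose_of_mem E hx]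
  exact DirectSum.toModule_lof (M := fun a => E a) k a ⟨x, hx⟩

end Graded

section Simple

variable {k 𝔤 : Type*} [Field k] [LieRing 𝔤] [LieAlgebra k 𝔤] [LieAlgebra.IsSimple k 𝔤]

/-- A simple Lie algebra has trivial centre. -/
theorem eq_zero_of_forall_lie_eq_zero (k : Type*) {𝔤 : Type*} [Field k] [LieRing 𝔤]
    [LieAlgebra k 𝔤] [LieAlgebra.IsSimple k 𝔤] {x : 𝔤} (h : ∀ y : 𝔤, ⁅x, y⁆ = 0) : x = 0 := by
  have h1 : LieAlgebra.center k 𝔤 = ⊥ := by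
    refine (LieAlgebra.IsSimple.eq_bot_or_eq_top (R := k) (LieAlgebra.center k 𝔤)).resolve_right
      fun h => LieAlgebra.IsSimple.non_abelian k (L := 𝔤) ⟨fun x y => ?_⟩
    have hy : y ∈ LieAlgebra.center k 𝔤 := h ▸ LieSubmodule.mem_top y
    exact (LieModule.mem_maxTrivSubmodule k 𝔤 𝔤 y).1 hy x
  have h2 : x ∈ LieAlgebra.center k 𝔤 := (LieModule.mem_maxTrivSubmodule k 𝔤 𝔤 x).2 fun y => by
    rw [← lie_skew, h, neg_zero]
  rwa [h1, LieSubmodule.mem_bot] at h2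

/-- A simple Lie algebra is spanned by its brackets. -/
theorem isPerfect_of_isSimple : IsPerfect k 𝔤 := by
  let I : LieIdeal k 𝔤 :=
    { Submodule.span k (Set.range fun p : 𝔤 × 𝔤 => ⁅p.1, p.2⁆) with
      lie_mem := fun {x y} _ => Submodule.subset_span ⟨(x, y), rfl⟩ }
  have hI : I = ⊤ := by
    refine (LieAlgebra.IsSimple.eq_bot_or_eq_top I).resolve_left fun h =>
      LieAlgebra.IsSimple.non_abelian k (L := 𝔤) ⟨fun x y => ?_⟩
    have : ⁅x, y⁆ ∈ I := Submodule.subset_span ⟨(x, y), rfl⟩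
    rwa [h, LieSubmodule.mem_bot] at this
  intro x
  have : x ∈ I := hI ▸ LieSubmodule.mem_top x
  exact this

/-- The centroid of a finite-dimensional simple Lie algebra over an algebraically closed field
consists of scalars. -/
theorem exists_eq_smul_of_map_lie [IsAlgClosed k] [FiniteDimensional k 𝔤] (φ : 𝔤 →ₗ[k] 𝔤)
    (hφ : ∀ x y, φ ⁅x, y⁆ = ⁅φ x, y⁆) : ∃ t : k, ∀ x, φ x = t • x := by
  have : Nontrivial 𝔤 := by
    by_contra h
    rw [not_nontrivial_iff_subsingleton] at h
    exact LieAlgebra.IsSimple.non_abelian k (L := 𝔤) ⟨fun x y => Subsingleton.elim _ _⟩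
  obtain ⟨t, ht⟩ := Module.End.exists_eigenvalue φ
  let I : LieIdeal k 𝔤 :=
    { Module.End.eigenspace φ t with
      lie_mem := fun {y x} hx => by
        change _ ∈ Module.End.eigenspace φ t
        have hx' : φ x = t • x := Module.End.mem_eigenspace_iff.1 hx
        rw [Module.End.mem_eigenspace_iff, ← lie_skew, map_neg, hφ, hx', smul_lie, smul_neg] }
  have hI : I = ⊤ := by
    refine (LieAlgebra.IsSimple.eq_bot_or_eq_top I).resolve_left fun h => ?_
    obtain ⟨x, hx, hx0⟩ := ht.exists_hasEigenvector
    have : x ∈ I := hx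
    rw [h, LieSubmodule.mem_bot] at this
    exact hx0 this
  refine ⟨t, fun x => ?_⟩
  have : x ∈ I := hI ▸ LieSubmodule.mem_top x
  exact Module.End.mem_eigenspace_iff.1 this

end Simple

section Classification

variable {k 𝔤 A Λ : Type*} [Field k] [IsAlgClosed k] [CharZero k] [LieRing 𝔤] [LieAlgebra k 𝔤]
  [FiniteDimensional k 𝔤] [LieAlgebra.IsSimple k 𝔤] [AddCommGroup A] [DecidableEq A] [Finite A]
  {E : A → Submodule k 𝔤} [GradedLieAlgebra E] [AddCommGroup Λ] (cls : Λ →+ A)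

/-- Let `D` be a family of maps which define a derivation `z^lam ⊗ x ↦ z^lam ⊗ D lam x` of the loop
algebra `⨁ lam, z^lam ⊗ 𝔤_{cls lam}` (up to a shift of the degree). Then `D` changes by scalars
along `ker cls`, since the change lies in the centroid of `𝔤`. -/
theorem exists_scalar_of_derivation (hcls : Function.Surjective cls) (D : Λ → 𝔤 →ₗ[k] 𝔤)
    (hD : ∀ lam nu x y, x ∈ E (cls lam) → y ∈ E (cls nu) →
      D (lam + nu) ⁅x, y⁆ = ⁅D lam x, y⁆ + ⁅x, D nu y⁆) (c : Λ) (hc : cls c = 0) :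
    ∃ t : k, ∀ lam, ∀ x ∈ E (cls lam), D (lam + c) x = D lam x + t • x := by
  have hclsc (lam : Λ) : cls (lam + c) = cls lam := by rw [map_add, hc, add_zero]
  have h1 (lam nu : Λ) (x y : 𝔤) (hx : x ∈ E (cls lam)) (hy : y ∈ E (cls nu)) :
      D (lam + nu + c) ⁅x, y⁆ - D (lam + nu) ⁅x, y⁆ = ⁅D (lam + c) x - D lam x, y⁆ := by
    have e := hD (lam + c) nu x y (by rwa [hclsc]) hy
    rw [add_right_comm] at e
    rw [e, hD lam nu x y hx hy, sub_lie]
    abel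
  have h2 (lam nu : Λ) (x y : 𝔤) (hx : x ∈ E (cls lam)) (hy : y ∈ E (cls nu)) :
      D (lam + nu + c) ⁅x, y⁆ - D (lam + nu) ⁅x, y⁆ = ⁅x, D (nu + c) y - D nu y⁆ := by
    have e := hD lam (nu + c) x y hx (by rwa [hclsc])
    rw [← add_assoc] at e
    rw [e, hD lam nu x y hx hy, lie_sub]
    abel
  -- the change depends on the class of the degree only
  have h3 (lam lam' : Λ) (h : cls lam = cls lam') (x : 𝔤) (hx : x ∈ E (cls lam)) :
      D (lam + c) x - D lam x = D (lam' + c) x - D lam' x := by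
    rw [← sub_eq_zero]
    refine eq_zero_of_forall_lie_eq_zero k fun y => ?_
    rw [sub_lie, sub_eq_zero]
    induction y using graded_induction E with
    | zero => simp
    | add y y' hy hy' => rw [lie_add, lie_add, hy, hy']
    | mem b y hy =>
      obtain ⟨nu, rfl⟩ := hcls b
      rw [← h1 lam nu x y hx hy, ← h1 lam' nu x y (h ▸ hx) hy, h2 lam nu x y hx hy,
        h2 lam' nu x y (h ▸ hx) hy]
  let φ : 𝔤 →ₗ[k] 𝔤 := gradedGlue E fun a =>
    D (Function.surjInv hcls a + c) - D (Function.surjInv hcls a)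
  have hφ (lam : Λ) (x : 𝔤) (hx : x ∈ E (cls lam)) : φ x = D (lam + c) x - D lam x := by
    rw [show φ x = _ from gradedGlue_of_mem _ hx]
    exact h3 _ _ (Function.surjInv_eq hcls _) x (by rwa [Function.surjInv_eq hcls])
  obtain ⟨t, ht⟩ := exists_eq_smul_of_map_lie φ fun x y => by
    induction x using graded_induction E with
    | zero => simp
    | add x x' h h' => simp only [add_lie, map_add, h, h']
    | mem a x hx =>
      induction y using graded_induction E with
      | zero => simp
      | add y y' h h' => simp only [lie_add, map_add, h, h']
      | mem b y hy =>
        obtain ⟨lam, rfl⟩ := hcls a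
        obtain ⟨nu, rfl⟩ := hcls b
        rw [hφ (lam + nu) _ (by rw [map_add]; exact lie_mem_graded hx hy), hφ lam x hx,
          h1 lam nu x y hx hy]
  refine ⟨t, fun lam x hx => ?_⟩
  rw [← ht x, hφ lam x hx, add_sub_cancel]

/-- Every homogeneous derivation of the loop algebra `⨁ lam, z^lam ⊗ 𝔤_{cls lam}` is the sum of an
inner derivation and of a degree derivation `z^lam ⊗ x ↦ θ(lam) z^lam ⊗ x`, up to the shift of the
degree. -/
theorem exists_inner_add_degree (hcls : Function.Surjective cls) (D : Λ → 𝔤 →ₗ[k] 𝔤)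
    (hD : ∀ lam nu x y, x ∈ E (cls lam) → y ∈ E (cls nu) →
      D (lam + nu) ⁅x, y⁆ = ⁅D lam x, y⁆ + ⁅x, D nu y⁆) :
    ∃ (w : 𝔤) (θ : Λ →+ k), ∀ lam, ∀ x ∈ E (cls lam), D lam x = ⁅w, x⁆ + θ lam • x := by
  choose θ₀ hθ₀ using exists_scalar_of_derivation (E := E) cls hcls D hD
  obtain ⟨lam₀, x₀, hx₀, hx₀ne⟩ : ∃ lam, ∃ x ∈ E (cls lam), x ≠ 0 := by
    by_contra! h
    refine LieAlgebra.IsSimple.non_abelian k (L := 𝔤) ⟨fun x y => ?_⟩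
    suffices x = 0 by rw [this, zero_lie]
    induction x using graded_induction E with
    | zero => rfl
    | add x x' h h' => rw [h, h', add_zero]
    | mem a x hx =>
      obtain ⟨lam, rfl⟩ := hcls a
      exact h lam x hx
  have hθ₀add (c c' : Λ) (hc : cls c = 0) (hc' : cls c' = 0) (h : cls (c + c') = 0) :
      θ₀ (c + c') h = θ₀ c hc + θ₀ c' hc' := by
    refine smul_left_injective k hx₀ne ?_
    have e1 := hθ₀ _ h lam₀ x₀ hx₀
    have e2 := hθ₀ c' hc' (lam₀ + c) x₀ (by rwa [map_add, hc, add_zero])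
    rw [add_assoc, e1, hθ₀ c hc lam₀ x₀ hx₀, add_assoc] at e2
    simpa only [add_smul] using add_left_cancel e2
  -- `θ₀` is defined on `ker cls`, a subgroup whose index is invertible in `k`
  have hN : (Nat.card A : k) ≠ 0 := Nat.cast_ne_zero.2 Nat.card_pos.ne'
  have hker (lam : Λ) : cls (Nat.card A • lam) = 0 := by rw [map_nsmul, card_nsmul_eq_zero']
  let θ : Λ →+ k := AddMonoidHom.mk' (fun lam => (Nat.card A : k)⁻¹ * θ₀ _ (hker lam))
    fun lam nu => by
      rw [← mul_add, ← hθ₀add _ _ _ _ (by rw [map_add, hker, hker, add_zero])]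
      congr 2
      exact smul_add _ _ _
  have hθ (c : Λ) (hc : cls c = 0) : θ c = θ₀ c hc := by
    have h (r : ℕ) (hr : cls (r • c) = 0) : θ₀ (r • c) hr = r * θ₀ c hc := by
      induction r with
      | zero =>
        have := hθ₀add 0 0 (map_zero _) (map_zero _) (by simp)
        simp only [add_zero, left_eq_add] at this
        simpa using this
      | succ r ih =>
        have hr' : cls (r • c) = 0 := by rw [map_nsmul, hc, smul_zero]
        have e := hθ₀add (r • c) c hr' hc (by rw [map_add, hr', hc, add_zero])
        rw [ih hr'] at e
        simp only [succ_nsmul]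
        rw [e]
        push_cast
        ring
    change (Nat.card A : k)⁻¹ * θ₀ _ (hker c) = _
    rw [h, inv_mul_cancel_left₀ hN]
  let D' : 𝔤 →ₗ[k] 𝔤 := gradedGlue E fun a =>
    D (Function.surjInv hcls a) - θ (Function.surjInv hcls a) • LinearMap.id
  have hD' (lam : Λ) (x : 𝔤) (hx : x ∈ E (cls lam)) : D' x = D lam x - θ lam • x := by
    rw [show D' x = _ from gradedGlue_of_mem _ hx]
    set nu := Function.surjInv hcls (cls lam) with hnu
    have hnu' : cls nu = cls lam := Function.surjInv_eq hcls _
    have hc : cls (lam - nu) = 0 := by rw [map_sub, hnu', sub_self]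
    have e := hθ₀ _ hc nu x (by rwa [hnu'])
    rw [add_sub_cancel, ← hθ _ hc, map_sub] at e
    rw [e, LinearMap.sub_apply, LinearMap.smul_apply, LinearMap.id_apply, sub_smul]
    abel
  let 𝒟 : LieDerivation k 𝔤 𝔤 :=
    { D' with
      leibniz' := fun x y => by
        change D' ⁅x, y⁆ = ⁅x, D' y⁆ - ⁅y, D' x⁆
        induction x using graded_induction E with
        | zero => simp
        | add x x' h h' => simp only [add_lie, lie_add, map_add, h, h']; abel
        | mem a x hx =>
          induction y using graded_induction E with
          | zero => simp
          | add y y' h h' => simp only [add_lie, lie_add, map_add, h, h']; abel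
          | mem b y hy =>
            obtain ⟨lam, rfl⟩ := hcls a
            obtain ⟨nu, rfl⟩ := hcls b
            rw [hD' (lam + nu) _ (by rw [map_add]; exact lie_mem_graded hx hy), hD' lam x hx,
              hD' nu y hy, hD lam nu x y hx hy, lie_sub, lie_sub, ← lie_skew y (D lam x),
              lie_smul, lie_smul, ← lie_skew y x, map_add, add_smul, smul_neg]
            abel }
  obtain ⟨w, hw⟩ := LieDerivation.IsKilling.exists_eq_ad 𝒟
  refine ⟨w, θ, fun lam x hx => ?_⟩
  have h1 : ⁅w, x⁆ = D' x := by
    have := LieDerivation.congr_fun hw x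
    rwa [LieDerivation.ad_apply_apply] at this
  rw [h1, hD' lam x hx, sub_add_cancel]

open LinearMap in
/-- A `2`-cocycle of the loop algebra `⨁ lam, z^lam ⊗ 𝔤_{cls lam}`, given by its values
`b lam nu x y` on the pairs `(z^lam ⊗ x, z^nu ⊗ y)`. In each total degree `mu` it is the sum of a
coboundary, given by a vector `w mu`, and of the cocycle given by a degree derivation `θ mu` which
kills `mu`. The Killing form turns the cocycle into a derivation. -/
theorem exists_of_graded_cocycle (hcls : Function.Surjective cls)
    (b : Λ → Λ → 𝔤 →ₗ[k] 𝔤 →ₗ[k] k)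
    (hskew : ∀ lam nu x y, x ∈ E (cls lam) → y ∈ E (cls nu) → b lam nu x y = - b nu lam y x)
    (hjac : ∀ lam nu tau x y z, x ∈ E (cls lam) → y ∈ E (cls nu) → z ∈ E (cls tau) →
      b lam (nu + tau) x ⁅y, z⁆ = b (lam + nu) tau ⁅x, y⁆ z + b nu (lam + tau) y ⁅x, z⁆) :
    ∃ (w : Λ → 𝔤) (θ : Λ → Λ →+ k), (∀ mu, θ mu mu = 0) ∧
      ∀ lam nu x y, x ∈ E (cls lam) → y ∈ E (cls nu) →
        b lam nu x y = killingForm k 𝔤 (w (lam + nu)) ⁅x, y⁆ +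
          θ (lam + nu) lam * killingForm k 𝔤 x y := by
  have hκ : (killingForm k 𝔤).Nondegenerate := LieAlgebra.IsKilling.killingForm_nondegenerate k 𝔤
  have hinv (x y z : 𝔤) : killingForm k 𝔤 ⁅x, y⁆ z = killingForm k 𝔤 x ⁅y, z⁆ :=
    LieModule.traceForm_apply_lie_apply k 𝔤 𝔤 x y z
  suffices ∀ mu, ∃ (w : 𝔤) (θ : Λ →+ k), θ mu = 0 ∧
      ∀ lam nu x y, lam + nu = mu → x ∈ E (cls lam) → y ∈ E (cls nu) →
        b lam nu x y = killingForm k 𝔤 w ⁅x, y⁆ + θ lam * killingForm k 𝔤 x y by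
    choose w θ h1 h2 using this
    exact ⟨w, θ, h1, fun lam nu x y hx hy => h2 _ lam nu x y rfl hx hy⟩
  intro mu
  let D (lam : Λ) : 𝔤 →ₗ[k] 𝔤 :=
    (BilinForm.toDual (killingForm k 𝔤) hκ).symm.toLinearMap ∘ₗ
      (b lam (mu - lam)).compl₂ (gradedProj E (cls (mu - lam)))
  have hDκ (lam : Λ) (x y : 𝔤) :
      killingForm k 𝔤 (D lam x) y = b lam (mu - lam) x (gradedProj E (cls (mu - lam)) y) := by
    exact BilinForm.apply_toDual_symm_apply (hB := hκ) _ _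
  obtain ⟨w, θ, hw⟩ := exists_inner_add_degree (E := E) cls hcls D fun lam nu x y hx hy => by
    rw [← sub_eq_zero]
    refine hκ.1 _ fun z => ?_
    have e1 : mu - lam = nu + (mu - (lam + nu)) := by abel
    have e2 : mu - nu = lam + (mu - (lam + nu)) := by abel
    have e3 : killingForm k 𝔤 ⁅D lam x, y⁆ z =
        b lam (nu + (mu - (lam + nu))) x ⁅y, gradedProj E (cls (mu - (lam + nu))) z⁆ := by
      rw [hinv, hDκ, e1, map_add cls nu, gradedProj_lie hy]
    have e4 : killingForm k 𝔤 ⁅x, D nu y⁆ z =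
        - b nu (lam + (mu - (lam + nu))) y ⁅x, gradedProj E (cls (mu - (lam + nu))) z⁆ := by
      rw [← lie_skew, map_neg, LinearMap.neg_apply, hinv, hDκ, e2, map_add cls lam,
        gradedProj_lie hx]
    rw [map_sub, map_add, LinearMap.sub_apply, LinearMap.add_apply, e3, e4, hDκ,
      hjac _ _ _ x y _ hx hy (gradedProj_mem E _ z)]
    ring
  have hb (lam nu : Λ) (x y : 𝔤) (h : lam + nu = mu) (hx : x ∈ E (cls lam))
      (hy : y ∈ E (cls nu)) :
      b lam nu x y = killingForm k 𝔤 w ⁅x, y⁆ + θ lam * killingForm k 𝔤 x y := by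
    have h1 := hDκ lam x y
    have h2 : mu - lam = nu := by rw [← h, add_sub_cancel_left]
    rw [h2, gradedProj_of_mem hy, hw lam x hx, map_add, map_smul, LinearMap.add_apply,
      LinearMap.smul_apply, hinv, smul_eq_mul] at h1
    exact h1.symm
  by_cases hmu : ∃ lam nu x y, lam + nu = mu ∧ x ∈ E (cls lam) ∧ y ∈ E (cls nu) ∧
      killingForm k 𝔤 x y ≠ 0
  · refine ⟨w, θ, ?_, hb⟩
    obtain ⟨lam, nu, x, y, h, hx, hy, hxy⟩ := hmu
    have e := hskew lam nu x y hx hy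
    rw [hb lam nu x y h hx hy, hb nu lam y x (by rwa [add_comm]) hy hx, ← lie_skew y x, map_neg,
      LieModule.traceForm_comm k 𝔤 𝔤 y x] at e
    rw [← h, map_add]
    refine (mul_eq_zero.1 (?_ : (θ lam + θ nu) * killingForm k 𝔤 x y = 0)).resolve_right hxy
    linear_combination e
  · push Not at hmu
    refine ⟨w, 0, rfl, fun lam nu x y h hx hy => ?_⟩
    rw [hb lam nu x y h hx hy, hmu lam nu x y h hx hy, mul_zero, mul_zero]

end Classification

/-! ### Kähler differentials of Laurent polynomials modulo exact forms -/

section KaehlerExt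

variable {k A V : Type*} [CommRing k] [CommRing A] [Algebra k A] [AddCommGroup V] [Module k V]

theorem kaehler_linearMap_ext {f g : Ω[A⁄k] →ₗ[k] V}
    (h : ∀ a b : A, f (a • KaehlerDifferential.D k A b) = g (a • KaehlerDifferential.D k A b)) :
    f = g := by
  refine LinearMap.ext fun ω => ?_
  have hω : ω ∈ Submodule.span A (Set.range (KaehlerDifferential.D k A)) := by
    rw [KaehlerDifferential.span_range_derivation]
    trivial
  suffices ∀ a : A, f (a • ω) = g (a • ω) by simpa only [one_smul] using this 1
  induction hω using Submodule.span_induction with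
  | zero => intro a; rw [smul_zero, map_zero, map_zero]
  | add x y _ _ hx hy => intro a; rw [smul_add, map_add, map_add, hx, hy]
  | smul b x _ hx => intro a; rw [smul_smul, hx]
  | mem x hx =>
    obtain ⟨b, rfl⟩ := hx
    exact fun a => h a b

theorem omegaModExact_linearMap_ext {f g : OmegaModExact k A →ₗ[k] V}
    (h : ∀ a b, f (adb k A a b) = g (adb k A a b)) : f = g :=
  Submodule.linearMap_qext _ (kaehler_linearMap_ext h)

/-- The class of `a db` as a difference of two differentials `s dt` and `s' dt'` with `s t = s' t'`;
the corresponding brackets in Kassel's algebra have the same component in `𝔤_S`. -/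
theorem adb_mul_sub (p q a b : A) (hpq : p * q = 1) :
    adb k A (p * a) (q * b) - adb k A (p * (a * b)) q = adb k A a b := by
  rw [adb_apply, adb_apply, adb_apply, ← map_sub, Derivation.leibniz, smul_add, smul_smul,
    smul_smul, mul_assoc p a b, add_sub_cancel_right]
  congr 2
  linear_combination a * hpq

end KaehlerExt

section Laurent

variable {k : Type*} [Field k] {n : ℕ}

variable (k) in
/-- The monomial `z^i`. -/
abbrev mon (i : Fin n → ℤ) : Laurent k n := AddMonoidAlgebra.single i 1

theorem mon_mul_mon (i j : Fin n → ℤ) : mon k i * mon k j = mon k (i + j) := by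
  simp [AddMonoidAlgebra.single_mul_single]

theorem mon_zero : mon k (0 : Fin n → ℤ) = 1 := rfl

theorem laurent_linearMap_ext {V : Type*} [AddCommGroup V] [Module k V]
    {f g : Laurent k n →ₗ[k] V} (h : ∀ i, f (mon k i) = g (mon k i)) : f = g :=
  (AddMonoidAlgebra.basis (Fin n → ℤ) k).ext h

/-- The linear map on Laurent polynomials with prescribed values on the monomials. -/
def ofMon {V : Type*} [AddCommGroup V] [Module k V] (f : (Fin n → ℤ) → V) : Laurent k n →ₗ[k] V :=
  (AddMonoidAlgebra.basis (Fin n → ℤ) k).constr k f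

@[simp] theorem ofMon_mon {V : Type*} [AddCommGroup V] [Module k V] (f : (Fin n → ℤ) → V)
    (i : Fin n → ℤ) : ofMon f (mon k i) = f i :=
  (AddMonoidAlgebra.basis (Fin n → ℤ) k).constr_basis k f i

/-- The Euler derivation `z_j ∂/∂z_j`. -/
def euler (j : Fin n) : Derivation k (Laurent k n) (Laurent k n) :=
  Derivation.mk' (ofMon fun i => (i j : k) • mon k i) fun a b => by
    have h : (LinearMap.mul k (Laurent k n)).compr₂ (ofMon fun i => (i j : k) • mon k i) =
        (LinearMap.mul k (Laurent k n)).compl₂ (ofMon fun i => (i j : k) • mon k i) +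
          (LinearMap.mul k (Laurent k n)) ∘ₗ (ofMon fun i => (i j : k) • mon k i) := by
      refine laurent_linearMap_ext fun i => laurent_linearMap_ext fun i' => ?_
      simp only [LinearMap.compr₂_apply, LinearMap.mul_apply', mon_mul_mon, ofMon_mon,
        LinearMap.add_apply, LinearMap.compl₂_apply, LinearMap.comp_apply, mul_smul_comm,
        smul_mul_assoc, ← add_smul, Pi.add_apply]
      push_cast
      rw [add_comm]
    have := LinearMap.congr_fun (LinearMap.congr_fun h a) b
    rw [smul_eq_mul, smul_eq_mul, mul_comm b]
    exact this

@[simp] theorem euler_mon (j : Fin n) (i : Fin n → ℤ) : euler j (mon k i) = (i j : k) • mon k i :=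
  ofMon_mon _ i

/-- The coordinate of a differential form along `dlog z_j`. -/
def omegaCoord (j : Fin n) : Ω[Laurent k n⁄k] →ₗ[Laurent k n] Laurent k n :=
  (euler j).liftKaehlerDifferential

theorem omegaCoord_D (j : Fin n) (a : Laurent k n) :
    omegaCoord j (KaehlerDifferential.D k _ a) = euler j a :=
  Derivation.liftKaehlerDifferential_comp_D _ _

variable (k) in
/-- The logarithmic differential `dlog z^i = z^{-i} d z^i`. -/
def dlog : (Fin n → ℤ) →+ Ω[Laurent k n⁄k] :=
  AddMonoidHom.mk' (fun i => mon k (-i) • KaehlerDifferential.D k _ (mon k i)) fun i j => by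
    rw [← mon_mul_mon, Derivation.leibniz, smul_add, smul_smul, smul_smul, mon_mul_mon,
      mon_mul_mon, add_comm]
    congr 3 <;> abel

theorem D_mon (i : Fin n → ℤ) : KaehlerDifferential.D k _ (mon k i) = mon k i • dlog k i := by
  change _ = mon k i • mon k (-i) • KaehlerDifferential.D k _ (mon k i)
  rw [smul_smul, mon_mul_mon, add_neg_cancel, mon_zero, one_smul]

theorem dlog_eq_sum (i : Fin n → ℤ) : dlog k i = ∑ j, (i j : k) • dlog k (Pi.single j 1) := by
  conv_lhs => rw [← Finset.univ_sum_single i]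
  rw [map_sum]
  refine Finset.sum_congr rfl fun j _ => ?_
  have : (Pi.single j (i j) : Fin n → ℤ) = i j • Pi.single j 1 := by
    rw [← Pi.single_smul, smul_eq_mul, mul_one]
  rw [this, map_zsmul, Int.cast_smul_eq_zsmul]

/-- The module `Ω_S` is spanned by the forms `dlog z_j`. -/
theorem eq_sum_omegaCoord (ω : Ω[Laurent k n⁄k]) :
    ω = ∑ j, omegaCoord j ω • dlog k (Pi.single j 1) := by
  have h : LinearMap.id = ∑ j, ((LinearMap.toSpanSingleton (Laurent k n) Ω[Laurent k n⁄k]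
      (dlog k (Pi.single j 1))) ∘ₗ omegaCoord j).restrictScalars k := by
    refine kaehler_linearMap_ext fun a b => ?_
    have h1 : (KaehlerDifferential.D k (Laurent k n) : Laurent k n →ₗ[k] Ω[Laurent k n⁄k]) =
        ∑ j, ((LinearMap.toSpanSingleton (Laurent k n) Ω[Laurent k n⁄k]
          (dlog k (Pi.single j 1))).restrictScalars k) ∘ₗ
            (euler (k := k) j : Laurent k n →ₗ[k] Laurent k n) := by
      refine laurent_linearMap_ext fun i => ?_
      simp only [LinearMap.sum_apply, LinearMap.comp_apply, Derivation.coeFn_coe, euler_mon,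
        LinearMap.restrictScalars_apply, LinearMap.toSpanSingleton_apply]
      rw [D_mon, dlog_eq_sum, Finset.smul_sum]
      refine Finset.sum_congr rfl fun j _ => ?_
      rw [smul_assoc, smul_comm]
    have h2 := LinearMap.congr_fun h1 b
    simp only [LinearMap.sum_apply, LinearMap.comp_apply, Derivation.coeFn_coe,
      LinearMap.restrictScalars_apply, LinearMap.toSpanSingleton_apply] at h2
    simp only [LinearMap.id_apply, LinearMap.sum_apply, LinearMap.comp_apply, map_smul,
      LinearMap.restrictScalars_apply, LinearMap.toSpanSingleton_apply, omegaCoord_D]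
    rw [h2, Finset.smul_sum]
  have := LinearMap.congr_fun h ω
  simpa only [LinearMap.id_apply, LinearMap.sum_apply, LinearMap.comp_apply,
    LinearMap.restrictScalars_apply, LinearMap.toSpanSingleton_apply] using this

/-- A family `θ mu` of additive functions on `ℤⁿ` with `θ mu mu = 0` defines a functional on
`Ω_S / dS`, which sends `z^i dz^j` to `θ (i + j) i = - θ (i + j) j`. -/
theorem exists_functional_omegaModExact (θ : (Fin n → ℤ) → (Fin n → ℤ) →+ k)
    (hθ : ∀ mu, θ mu mu = 0) :
    ∃ f : OmegaModExact k (Laurent k n) →ₗ[k] k,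
      ∀ i j, f (adb k _ (mon k i) (mon k j)) = θ (i + j) i := by
  have hsum (mu i : Fin n → ℤ) : ∑ l, (i l : k) * θ mu (Pi.single l 1) = θ mu i := by
    conv_rhs => rw [← Finset.univ_sum_single i, map_sum]
    refine Finset.sum_congr rfl fun l _ => ?_
    have : (Pi.single l (i l) : Fin n → ℤ) = i l • Pi.single l 1 := by
      rw [← Pi.single_smul, smul_eq_mul, mul_one]
    rw [this, map_zsmul, zsmul_eq_mul]
  -- `f (z^mu dlog z_l) = - θ mu e_l`
  let f : Ω[Laurent k n⁄k] →ₗ[k] k :=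
    -∑ l, (ofMon fun mu => θ mu (Pi.single l 1)) ∘ₗ (omegaCoord l).restrictScalars k
  have hf (i j : Fin n → ℤ) :
      f (mon k i • KaehlerDifferential.D k _ (mon k j)) = -θ (i + j) j := by
    simp only [f, LinearMap.neg_apply, LinearMap.sum_apply, LinearMap.comp_apply,
      LinearMap.restrictScalars_apply, map_smul, omegaCoord_D, euler_mon, smul_eq_mul,
      mul_smul_comm, mon_mul_mon, ofMon_mon]
    rw [hsum]
  refine ⟨(exactForms k (Laurent k n)).liftQ f ?_, fun i j => ?_⟩
  · suffices f ∘ₗ (KaehlerDifferential.D k (Laurent k n) : _ →ₗ[k] _) = 0 by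
      rintro _ ⟨a, rfl⟩
      exact LinearMap.congr_fun this a
    refine laurent_linearMap_ext fun j => ?_
    have h := hf 0 j
    rwa [mon_zero, one_smul, zero_add, hθ, neg_zero] at h
  · have h : θ (i + j) i + θ (i + j) j = 0 := by rw [← map_add, hθ]
    exact (hf i j).trans (eq_neg_of_add_eq_zero_left h).symm

theorem laurentIncl_mon (m : Fin n → ℕ) (i : Fin n → ℤ) :
    laurentIncl k m (mon k i) = mon k fun j => (m j : ℤ) * i j := by
  simp [laurentIncl]

theorem euler_laurentIncl (m : Fin n → ℕ) (j : Fin n) (a : Laurent k n) :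
    euler j (laurentIncl k m a) = (m j : k) • laurentIncl k m (euler j a) := by
  have h : (euler (k := k) j : Laurent k n →ₗ[k] Laurent k n) ∘ₗ (laurentIncl k m).toLinearMap =
      (m j : k) • (laurentIncl k m).toLinearMap ∘ₗ
        (euler (k := k) j : Laurent k n →ₗ[k] Laurent k n) := by
    refine laurent_linearMap_ext fun i => ?_
    simp only [LinearMap.comp_apply, AlgHom.toLinearMap_apply, laurentIncl_mon,
      Derivation.coeFn_coe, euler_mon, LinearMap.smul_apply, map_smul, smul_smul]
    push_cast
    rfl
  exact LinearMap.congr_fun h a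

theorem omegaCoord_mapOmega_laurentIncl (m : Fin n → ℕ) (j : Fin n) (ω : Ω[Laurent k n⁄k]) :
    omegaCoord j (mapOmega (laurentIncl k m) ω) =
      (m j : k) • laurentIncl k m (omegaCoord j ω) := by
  have h : (omegaCoord j).restrictScalars k ∘ₗ mapOmega (laurentIncl k m) =
      (m j : k) • (laurentIncl k m).toLinearMap ∘ₗ (omegaCoord j).restrictScalars k := by
    refine kaehler_linearMap_ext fun a b => ?_
    simp only [LinearMap.comp_apply, LinearMap.smul_apply, mapOmega_smul_D,
      LinearMap.restrictScalars_apply, map_smul, omegaCoord_D, euler_laurentIncl,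
      AlgHom.toLinearMap_apply, smul_eq_mul, map_mul, mul_smul_comm]
  exact LinearMap.congr_fun h ω

/-- The left inverse of the inclusion `R ⊆ S` which kills the monomials outside of `R`. -/
def laurentRestrict (m : Fin n → ℕ) : Laurent k n →ₗ[k] Laurent k n :=
  open Classical in
  ofMon fun i => if ∀ j, (m j : ℤ) ∣ i j then mon k fun j => i j / m j else 0

theorem laurentRestrict_laurentIncl {m : Fin n → ℕ} (hm : ∀ j, 0 < m j) (a : Laurent k n) :
    laurentRestrict m (laurentIncl k m a) = a := by
  have h : laurentRestrict m ∘ₗ (laurentIncl k m).toLinearMap = LinearMap.id := by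
    refine laurent_linearMap_ext fun i => ?_
    rw [LinearMap.comp_apply, AlgHom.toLinearMap_apply, laurentIncl_mon, laurentRestrict,
      ofMon_mon, if_pos fun j => dvd_mul_right _ _, LinearMap.id_apply]
    congr 1
    ext j
    exact Int.mul_ediv_cancel_left _ (by exact_mod_cast (hm j).ne')
  exact LinearMap.congr_fun h a

theorem laurentRestrict_euler (m : Fin n → ℕ) (j : Fin n) (a : Laurent k n) :
    laurentRestrict m (euler j a) = (m j : k) • euler j (laurentRestrict m a) := by
  have h : laurentRestrict m ∘ₗ (euler (k := k) j : Laurent k n →ₗ[k] Laurent k n) =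
      (m j : k) • (euler (k := k) j : Laurent k n →ₗ[k] Laurent k n) ∘ₗ laurentRestrict m := by
    refine laurent_linearMap_ext fun i => ?_
    simp only [LinearMap.comp_apply, LinearMap.smul_apply, Derivation.coeFn_coe, euler_mon,
      map_smul, laurentRestrict, ofMon_mon]
    split_ifs with hi
    · rw [euler_mon, smul_smul]
      congr 1
      exact_mod_cast congrArg (Int.cast (R := k)) (Int.mul_ediv_cancel' (hi j)).symm
    · simp
  exact LinearMap.congr_fun h a

variable [CharZero k]

/-- The map `Ω_R / dR → Ω_S / dS` is injective. -/
theorem mapOmegaModExact_laurentIncl_injective {m : Fin n → ℕ} (hm : ∀ j, 0 < m j) :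
    Function.Injective (mapOmegaModExact (laurentIncl k m)) := by
  rw [injective_iff_map_eq_zero]
  intro x hx
  obtain ⟨ω, rfl⟩ := Submodule.mkQ_surjective _ x
  have hx' : mapOmega (laurentIncl k m) ω ∈ exactForms k (Laurent k n) :=
    (Submodule.Quotient.mk_eq_zero _).1 hx
  obtain ⟨s, hs⟩ := hx'
  refine (Submodule.Quotient.mk_eq_zero _).2 ⟨laurentRestrict m s, ?_⟩
  rw [Derivation.coeFn_coe] at hs ⊢
  rw [eq_sum_omegaCoord ω, eq_sum_omegaCoord (KaehlerDifferential.D k _ _)]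
  refine Finset.sum_congr rfl fun j _ => ?_
  congr 1
  have h := congrArg (laurentRestrict m ∘ omegaCoord j) hs
  simp only [Function.comp_apply, omegaCoord_D, omegaCoord_mapOmega_laurentIncl, map_smul,
    laurentRestrict_laurentIncl hm, laurentRestrict_euler] at h
  rw [omegaCoord_D]
  exact smul_right_injective _ (Nat.cast_ne_zero.2 (hm j).ne' : (m j : k) ≠ 0) h

end Laurent

section Galois

variable {k : Type*} [Field k] {n : ℕ} {m : Fin n → ℕ} {ζ : Fin n → kˣ}

theorem galLaurent_mon (a : ∀ j, ZMod (m j)) (i : Fin n → ℤ) :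
    galLaurent ζ a (mon k i) = (galScalar ζ a i : k) • mon k i := by
  simp [galLaurent]

theorem galScalar_add_right (a : ∀ j, ZMod (m j)) (i i' : Fin n → ℤ) :
    galScalar ζ a (i + i') = galScalar ζ a i * galScalar ζ a i' := by
  simp [galScalar, zpow_add, Finset.prod_mul_distrib]

theorem pow_val_add (hm : ∀ j, 0 < m j) (hζ : ∀ j, IsPrimitiveRoot (ζ j) (m j)) (j : Fin n)
    (a b : ZMod (m j)) : ζ j ^ (a + b).val = ζ j ^ a.val * ζ j ^ b.val := by
  have : NeZero (m j) := ⟨(hm j).ne'⟩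
  rw [ZMod.val_add, ← pow_add, ← pow_mod_orderOf (ζ j) (a.val + b.val), ← (hζ j).eq_orderOf]

theorem pow_val_one (hζ : ∀ j, IsPrimitiveRoot (ζ j) (m j)) (j : Fin n) :
    ζ j ^ (1 : ZMod (m j)).val = ζ j := by
  rw [ZMod.val_one_eq_one_mod]
  conv_rhs => rw [← pow_one (ζ j), ← pow_mod_orderOf, ← (hζ j).eq_orderOf]

theorem galScalar_add_left (hm : ∀ j, 0 < m j) (hζ : ∀ j, IsPrimitiveRoot (ζ j) (m j))
    (a b : ∀ j, ZMod (m j)) (i : Fin n → ℤ) :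
    galScalar ζ (a + b) i = galScalar ζ a i * galScalar ζ b i := by
  simp only [galScalar, ← Finset.prod_mul_distrib]
  refine Finset.prod_congr rfl fun j _ => ?_
  rw [Pi.add_apply, pow_val_add hm hζ, mul_zpow]

theorem galScalar_single (hζ : ∀ j, IsPrimitiveRoot (ζ j) (m j)) (j : Fin n) (i : Fin n → ℤ) :
    galScalar ζ (Pi.single j 1 : ∀ j, ZMod (m j)) i = ζ j ^ i j := by
  rw [galScalar, Finset.prod_eq_single j]
  · rw [Pi.single_eq_same, pow_val_one hζ]
  · intro l _ hl
    rw [Pi.single_eq_of_ne hl, ZMod.val_zero, pow_zero, one_zpow]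
  · simp

/-- Orthogonality: a nontrivial character of the Galois group sums to zero. -/
theorem sum_galScalar_eq_zero [∀ j, NeZero (m j)] (hζ : ∀ j, IsPrimitiveRoot (ζ j) (m j))
    {i : Fin n → ℤ} (hi : ¬ ∀ j, (m j : ℤ) ∣ i j) :
    ∑ a : ∀ j, ZMod (m j), (galScalar ζ a i : k) = 0 := by
  have hm (j : Fin n) : 0 < m j := Nat.pos_of_ne_zero (NeZero.ne _)
  push Not at hi
  obtain ⟨j, hj⟩ := hi
  -- translation by the `j`-th generator multiplies the sum by `ζ_j^{i_j} ≠ 1`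
  have h := Equiv.sum_comp (Equiv.addRight (Pi.single j 1 : ∀ j, ZMod (m j)))
    fun a => (galScalar ζ a i : k)
  simp only [Equiv.coe_addRight, galScalar_add_left hm hζ, galScalar_single hζ, Units.val_mul,
    ← Finset.sum_mul] at h
  have hne : ((ζ j ^ i j : kˣ) : k) ≠ 1 := fun h =>
    hj (((hζ j).zpow_eq_one_iff_dvd _).1 (Units.val_eq_one.1 h))
  by_contra h0
  exact hne (mul_left_cancel₀ h0 (by rw [h, mul_one]))

theorem mapOmegaModExact_galLaurent_adb (a : ∀ j, ZMod (m j)) (i j : Fin n → ℤ) :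
    mapOmegaModExact (galLaurent ζ a) (adb k _ (mon k i) (mon k j)) =
      (galScalar ζ a (i + j) : k) • adb k _ (mon k i) (mon k j) := by
  rw [mapOmegaModExact_adb, galLaurent_mon, galLaurent_mon, map_smul, map_smul,
    LinearMap.smul_apply, smul_smul, galScalar_add_right, Units.val_mul, mul_comm]

theorem galLaurent_laurentIncl (hζ : ∀ j, IsPrimitiveRoot (ζ j) (m j)) (a : ∀ j, ZMod (m j))
    (r : Laurent k n) : galLaurent ζ a (laurentIncl k m r) = laurentIncl k m r := by
  have h : (galLaurent ζ a).toLinearMap ∘ₗ (laurentIncl k m).toLinearMap =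
      (laurentIncl k m).toLinearMap := by
    refine laurent_linearMap_ext fun i => ?_
    simp only [LinearMap.comp_apply, AlgHom.toLinearMap_apply, laurentIncl_mon, galLaurent_mon]
    have : galScalar ζ a (fun j => (m j : ℤ) * i j) = 1 := by
      refine Finset.prod_eq_one fun j _ => ?_
      rw [zpow_mul, zpow_natCast, ← pow_mul, mul_comm, pow_mul, (hζ j).pow_eq_one, one_pow,
        one_zpow]
    rw [this, Units.val_one, one_smul]
  exact LinearMap.congr_fun h r

theorem mapOmega_laurentIncl_smul_dlog (m : Fin n → ℕ) (r : Laurent k n) (j : Fin n) :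
    mapOmega (laurentIncl k m) (r • dlog k (Pi.single j 1)) =
      (m j : k) • laurentIncl k m r • dlog k (Pi.single j 1) := by
  have h : (fun l => (m l : ℤ) * (Pi.single j 1 : Fin n → ℤ) l) = m j • Pi.single j 1 := by
    ext l
    by_cases h : l = j
    · subst h; simp
    · simp [h]
  change mapOmega (laurentIncl k m) (r • mon k (-Pi.single j 1) •
    KaehlerDifferential.D k (Laurent k n) (mon k (Pi.single j 1))) = _
  have h' : (fun l => (m l : ℤ) * (-Pi.single j 1 : Fin n → ℤ) l) = -(m j • Pi.single j 1) := by
    rw [← h]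
    ext l
    simp
  rw [smul_smul, mapOmega_smul_D, map_mul, laurentIncl_mon, laurentIncl_mon, h, h', mul_smul]
  change laurentIncl k m r • dlog k (m j • Pi.single j 1) = _
  rw [map_nsmul, ← Nat.cast_smul_eq_nsmul k, smul_comm]

variable [CharZero k]

/-- The elements of `Ω_S / dS` fixed by the Galois group come from `Ω_R / dR`. -/
theorem exists_mapOmegaModExact_laurentIncl_eq (hm : ∀ j, 0 < m j)
    (hζ : ∀ j, IsPrimitiveRoot (ζ j) (m j)) {y : OmegaModExact k (Laurent k n)}
    (hy : ∀ a : ∀ j, ZMod (m j), mapOmegaModExact (galLaurent ζ a) y = y) :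
    ∃ x, mapOmegaModExact (laurentIncl k m) x = y := by
  have (j : Fin n) : NeZero (m j) := ⟨(hm j).ne'⟩
  -- the sum over the Galois group takes values in the image of `Ω_R / dR`
  have hT : (LinearMap.range (mapOmegaModExact (laurentIncl k m))).mkQ ∘ₗ
      ∑ a : ∀ j, ZMod (m j), mapOmegaModExact (galLaurent ζ a) = 0 := by
    refine omegaModExact_linearMap_ext fun a b => ?_
    suffices (adb k (Laurent k n)).compr₂
        ((LinearMap.range (mapOmegaModExact (laurentIncl k m))).mkQ ∘ₗ
          ∑ a : ∀ j, ZMod (m j), mapOmegaModExact (galLaurent ζ a)) = 0 from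
      LinearMap.congr_fun (LinearMap.congr_fun this a) b
    refine laurent_linearMap_ext fun i => laurent_linearMap_ext fun j => ?_
    simp only [LinearMap.compr₂_apply, LinearMap.comp_apply, LinearMap.sum_apply,
      mapOmegaModExact_galLaurent_adb, LinearMap.zero_apply, ← Finset.sum_smul]
    by_cases hij : ∀ l, (m l : ℤ) ∣ (i + j) l
    · choose c hc using hij
      have hc' : mon k (i + j) = laurentIncl k m (mon k c) := by
        rw [laurentIncl_mon]
        congr 1
        ext l
        exact hc l
      refine (Submodule.Quotient.mk_eq_zero _).2 (Submodule.smul_mem _ _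
        ⟨(exactForms k _).mkQ (∑ l, ((j l : k) / m l) • mon k c • dlog k (Pi.single l 1)), ?_⟩)
      change (exactForms k _).mkQ (mapOmega (laurentIncl k m) _) = _
      rw [adb_apply, D_mon, smul_smul, mon_mul_mon, hc', dlog_eq_sum, map_sum, Finset.smul_sum]
      congr 1
      refine Finset.sum_congr rfl fun l _ => ?_
      rw [map_smul, mapOmega_laurentIncl_smul_dlog, smul_smul,
        div_mul_cancel₀ _ (Nat.cast_ne_zero.2 (hm l).ne'), smul_comm]
    · rw [sum_galScalar_eq_zero hζ hij, zero_smul, map_zero]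
  have h := LinearMap.congr_fun hT y
  simp only [LinearMap.comp_apply, LinearMap.sum_apply, hy, Finset.sum_const,
    LinearMap.zero_apply] at h
  have h2 := (Submodule.Quotient.mk_eq_zero _).1 h
  rw [← Nat.cast_smul_eq_nsmul k] at h2
  exact (Submodule.smul_mem_iff _ (Nat.cast_ne_zero.2 Fintype.card_ne_zero)).1 h2

end Galois

/-! ### The grading of `𝔤` by simultaneous eigenspaces -/

section Eigenspaces

variable {k 𝔤 : Type*} [Field k] [LieRing 𝔤] [LieAlgebra k 𝔤] {n : ℕ} {m : Fin n → ℕ}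
  {ζ : Fin n → kˣ} {σ : Fin n → (𝔤 ≃ₗ⁅k⁆ 𝔤)}

variable (m) in
/-- The reduction `ℤⁿ → ∏_j ℤ/m_j`. -/
def gradeClass : (Fin n → ℤ) →+ ∀ j, ZMod (m j) :=
  AddMonoidHom.mk' (fun i j => (i j : ZMod (m j))) fun i i' => by ext j; simp

theorem gradeClass_surjective : Function.Surjective (gradeClass m) := fun a => by
  choose i hi using fun j => ZMod.intCast_surjective (a j)
  exact ⟨i, funext hi⟩

theorem gradeClass_laurentIncl (c : Fin n → ℤ) :
    gradeClass m (fun j => (m j : ℤ) * c j) = 0 := by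
  ext j
  simp [gradeClass]

variable (m ζ σ) in
/-- The simultaneous eigenspaces of `σ₁, …, σ_n`, indexed by `∏_j ℤ/m_j`. -/
def eigenGrading (a : ∀ j, ZMod (m j)) : Submodule k 𝔤 :=
  simulEigenspace σ ζ fun j => (a j).val

theorem mem_simulEigenspace {i : Fin n → ℤ} {x : 𝔤} :
    x ∈ simulEigenspace σ ζ i ↔ ∀ j, σ j x = ((ζ j ^ i j : kˣ) : k) • x := Iff.rfl

theorem eigenGrading_gradeClass (hm : ∀ j, 0 < m j) (hζ : ∀ j, IsPrimitiveRoot (ζ j) (m j))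
    (i : Fin n → ℤ) : eigenGrading m ζ σ (gradeClass m i) = simulEigenspace σ ζ i := by
  ext x
  simp only [eigenGrading, mem_simulEigenspace]
  refine forall_congr' fun j => ?_
  have : NeZero (m j) := ⟨(hm j).ne'⟩
  have h : ζ j ^ (((gradeClass m i) j).val : ℤ) = ζ j ^ i j := by
    change ζ j ^ (((i j : ZMod (m j))).val : ℤ) = _
    rw [ZMod.val_intCast]
    conv_lhs => rw [(hζ j).eq_orderOf]
    exact zpow_mod_orderOf _ _
  rw [h]

theorem lie_mem_simulEigenspace {i i' : Fin n → ℤ} {x y : 𝔤} (hx : x ∈ simulEigenspace σ ζ i)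
    (hy : y ∈ simulEigenspace σ ζ i') : ⁅x, y⁆ ∈ simulEigenspace σ ζ (i + i') := fun j => by
  rw [LieEquiv.map_lie, hx j, hy j, smul_lie, lie_smul, smul_smul, Pi.add_apply, zpow_add,
    Units.val_mul]

variable [IsAlgClosed k] [CharZero k] [FiniteDimensional k 𝔤]

open Module.End in
/-- Commuting automorphisms of finite order are simultaneously diagonalizable, with eigenvalues that
are powers of the `ζ_j`. -/
theorem eigenGrading_isInternal (hm : ∀ j, 0 < m j) (hζ : ∀ j, IsPrimitiveRoot (ζ j) (m j))
    (hσ : ∀ j x, (σ j)^[m j] x = x) (hcomm : ∀ i j x, σ i (σ j x) = σ j (σ i x)) :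
    DirectSum.IsInternal (eigenGrading m ζ σ) := by
  have (j : Fin n) : NeZero (m j) := ⟨(hm j).ne'⟩
  let f (j : Fin n) : Module.End k 𝔤 := (σ j : 𝔤 →ₗ[k] 𝔤)
  have hf (j : Fin n) (x : 𝔤) : f j x = σ j x := rfl
  have hfpow (j : Fin n) : f j ^ m j = 1 := by
    ext x
    rw [Module.End.coe_pow]
    exact hσ j x
  -- each `σ_j` is killed by the squarefree polynomial `X^{m_j} - 1`, hence diagonalizable
  have hss (j : Fin n) : (f j).IsFinitelySemisimple := by
    refine Module.End.IsSemisimple.isFinitelySemisimple ?_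
    refine isSemisimple_of_squarefree_aeval_eq_zero (p := Polynomial.X ^ m j - 1)
      (Polynomial.Separable.squarefree ?_) ?_
    · exact Polynomial.X_pow_sub_one_separable_iff.2 (Nat.cast_ne_zero.2 (hm j).ne')
    · simp [hfpow]
  have hmaps (i j : Fin n) (φ : k) :
      Set.MapsTo (f i) ((f j).maxGenEigenspace φ) ((f j).maxGenEigenspace φ) := by
    refine mapsTo_maxGenEigenspace_of_comm ?_ φ
    ext x
    exact hcomm j i x
  have hind := independent_iInf_maxGenEigenspace_of_forall_mapsTo f hmaps
  have htop := iSup_iInf_maxGenEigenspace_eq_top_of_forall_mapsTo f hmaps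
    fun i => iSup_maxGenEigenspace_eq_top (f i)
  simp only [fun j => (hss j).maxGenEigenspace_eq_eigenspace] at hind htop
  let χ (a : ∀ j, ZMod (m j)) (j : Fin n) : k := ((ζ j ^ ((a j).val : ℤ) : kˣ) : k)
  have hχ : Function.Injective χ := fun a b hab => by
    ext j
    have h := congrFun hab j
    simp only [χ, zpow_natCast] at h
    exact ZMod.val_injective _ ((hζ j).pow_inj (ZMod.val_lt _) (ZMod.val_lt _) (Units.ext h))
  have hE (a : ∀ j, ZMod (m j)) :
      eigenGrading m ζ σ a = ⨅ j, (f j).eigenspace (χ a j) := by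
    ext x
    simp only [eigenGrading, mem_simulEigenspace, Submodule.mem_iInf, mem_eigenspace_iff]
    rfl
  refine DirectSum.isInternal_submodule_of_iSupIndep_of_iSup_eq_top ?_ ?_
  · simp only [iSupIndep.eq_1, hE]
    exact hind.comp hχ
  · rw [eq_top_iff, ← htop]
    refine iSup_le fun ψ => ?_
    intro x hx
    by_cases hx0 : x = 0
    · rw [hx0]
      exact zero_mem _
    have hψ (j : Fin n) : ψ j ^ m j = 1 := by
      have hxj : f j x = ψ j • x := mem_eigenspace_iff.1 (Submodule.mem_iInf _ |>.1 hx j)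
      have h (r : ℕ) : (f j ^ r) x = ψ j ^ r • x := by
        induction r with
        | zero => simp
        | succ r ih => rw [pow_succ', Module.End.mul_apply, ih, map_smul, hxj, smul_smul, pow_succ]
      have h1 := h (m j)
      rw [hfpow, Module.End.one_apply] at h1
      exact smul_left_injective k hx0 (by simpa using h1.symm)
    choose i hi hi' using fun j =>
      ((hζ j).map_of_injective Units.coeHom_injective).eq_pow_of_pow_eq_one (hψ j)
    refine Submodule.mem_iSup_of_mem (gradeClass m fun j => (i j : ℤ)) ?_
    rw [eigenGrading_gradeClass hm hζ]
    intro j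
    have hxj : f j x = ψ j • x := mem_eigenspace_iff.1 (Submodule.mem_iInf _ |>.1 hx j)
    rw [← hf, hxj, ← hi' j, zpow_natCast, Units.val_pow_eq_pow_val]
    rfl

/-- The grading of `𝔤` by `∏_j ℤ/m_j`. It is not an instance, since it depends on hypotheses on `σ`
and `ζ`. -/
@[reducible]
def eigenGradedLieAlgebra (hm : ∀ j, 0 < m j) (hζ : ∀ j, IsPrimitiveRoot (ζ j) (m j))
    (hσ : ∀ j x, (σ j)^[m j] x = x) (hcomm : ∀ i j x, σ i (σ j x) = σ j (σ i x)) :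
    GradedLieAlgebra (eigenGrading m ζ σ) where
  bracket_mem a b x y hx hy := by
    obtain ⟨i, rfl⟩ := gradeClass_surjective a
    obtain ⟨i', rfl⟩ := gradeClass_surjective b
    rw [eigenGrading_gradeClass hm hζ] at hx hy
    rw [← map_add, eigenGrading_gradeClass hm hζ]
    exact lie_mem_simulEigenspace hx hy
  toDecomposition := (eigenGrading_isInternal hm hζ hσ hcomm).chooseDecomposition

end Eigenspaces

/-! ### The multiloop algebra as an algebra of fixed points -/

section Multiloop

variable {k 𝔤 : Type*} [Field k] [LieRing 𝔤] [LieAlgebra k 𝔤] {n : ℕ}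

theorem loop_linearMap_ext {V : Type*} [AddCommGroup V] [Module k V]
    {f g : Laurent k n ⊗[k] 𝔤 →ₗ[k] V} (h : ∀ i x, f (mon k i ⊗ₜ x) = g (mon k i ⊗ₜ x)) :
    f = g := by
  refine TensorProduct.ext (laurent_linearMap_ext fun i => LinearMap.ext fun x => ?_)
  exact h i x

variable (k 𝔤) in
/-- The coefficient of `z^i` in an element of `𝔤_S`. -/
def loopCoeff (i : Fin n → ℤ) : Laurent k n ⊗[k] 𝔤 →ₗ[k] 𝔤 :=
  Finsupp.lapply i ∘ₗ
    (TensorProduct.equivFinsuppOfBasisLeft (AddMonoidAlgebra.basis (Fin n → ℤ) k)).toLinearMap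

theorem loopCoeff_mon_self (i : Fin n → ℤ) (x : 𝔤) :
    loopCoeff k 𝔤 i (mon k i ⊗ₜ[k] x) = x := by
  have h := TensorProduct.equivFinsuppOfBasisLeft_apply_tmul_apply
    (AddMonoidAlgebra.basis (Fin n → ℤ) k) (mon k i) x i
  rw [show mon k i = AddMonoidAlgebra.basis (Fin n → ℤ) k i from rfl, Module.Basis.repr_self,
    Finsupp.single_eq_same, one_smul] at h
  exact h

theorem loopCoeff_mon_of_ne {i j : Fin n → ℤ} (hij : i ≠ j) (x : 𝔤) :
    loopCoeff k 𝔤 i (mon k j ⊗ₜ[k] x) = 0 := by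
  have h := TensorProduct.equivFinsuppOfBasisLeft_apply_tmul_apply
    (AddMonoidAlgebra.basis (Fin n → ℤ) k) (mon k j) x i
  rw [show mon k j = AddMonoidAlgebra.basis (Fin n → ℤ) k j from rfl, Module.Basis.repr_self,
    Finsupp.single_eq_of_ne hij, zero_smul] at h
  exact h

theorem loop_eq_sum (X : Laurent k n ⊗[k] 𝔤) :
    ∃ s : Finset (Fin n → ℤ), X = ∑ i ∈ s, mon k i ⊗ₜ loopCoeff k 𝔤 i X := by
  let Φ := TensorProduct.equivFinsuppOfBasisLeft (N := 𝔤) (AddMonoidAlgebra.basis (Fin n → ℤ) k)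
  refine ⟨(Φ X).support, ?_⟩
  conv_lhs => rw [← Φ.symm_apply_apply X]
  exact TensorProduct.equivFinsuppOfBasisLeft_symm_apply _ _

theorem loop_ext {X Y : Laurent k n ⊗[k] 𝔤} (h : ∀ i, loopCoeff k 𝔤 i X = loopCoeff k 𝔤 i Y) :
    X = Y := by
  have h' : X - Y = 0 := by
    obtain ⟨s, hs⟩ := loop_eq_sum (X - Y)
    rw [hs]
    refine Finset.sum_eq_zero fun i _ => ?_
    rw [map_sub, h, sub_self, TensorProduct.tmul_zero]
  exact sub_eq_zero.1 h'

variable {m : Fin n → ℕ} {ζ : Fin n → kˣ} {σ : Fin n → (𝔤 ≃ₗ⁅k⁆ 𝔤)}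

theorem mon_tmul_mem_multiloop {i : Fin n → ℤ} {x : 𝔤} (hx : x ∈ simulEigenspace σ ζ i) :
    mon k i ⊗ₜ x ∈ multiloop σ ζ :=
  Submodule.mem_iSup_of_mem i ⟨x, hx, rfl⟩

/-- The multiloop algebra consists of the elements whose coefficient of `z^i` is a simultaneous
eigenvector of weight `i`. -/
theorem mem_multiloop_iff {X : Laurent k n ⊗[k] 𝔤} :
    X ∈ multiloop σ ζ ↔ ∀ i, loopCoeff k 𝔤 i X ∈ simulEigenspace σ ζ i := by
  refine ⟨fun hX i => ?_, fun hX => ?_⟩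
  · suffices (multiloop σ ζ).toSubmodule ≤ (simulEigenspace σ ζ i).comap (loopCoeff k 𝔤 i) from
      this hX
    refine iSup_le fun j => ?_
    rintro _ ⟨x, hx, rfl⟩
    change loopCoeff k 𝔤 i (mon k j ⊗ₜ[k] x) ∈ simulEigenspace σ ζ i
    by_cases h : i = j
    · subst h
      rwa [loopCoeff_mon_self]
    · rw [loopCoeff_mon_of_ne h]
      exact zero_mem _
  · obtain ⟨s, hs⟩ := loop_eq_sum X
    rw [hs]
    exact sum_mem fun i _ => mon_tmul_mem_multiloop (hX i)

theorem loopCoeff_twist (v : 𝔤 →ₗ⁅k⁆ 𝔤) (a : ∀ j, ZMod (m j)) (i : Fin n → ℤ)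
    (X : Laurent k n ⊗[k] 𝔤) :
    loopCoeff k 𝔤 i (constLoop v (galLoop (galLaurent ζ a) X)) =
      (galScalar ζ a i : k) • v (loopCoeff k 𝔤 i X) := by
  have h : loopCoeff k 𝔤 i ∘ₗ ((constLoop v).comp
      (galLoop (galLaurent ζ a)) : Laurent k n ⊗[k] 𝔤 →ₗ⁅k⁆ Laurent k n ⊗[k] 𝔤).toLinearMap =
      (galScalar ζ a i : k) • (v : 𝔤 →ₗ[k] 𝔤) ∘ₗ loopCoeff k 𝔤 i := by
    refine loop_linearMap_ext fun j x => ?_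
    change loopCoeff k 𝔤 i (galLaurent ζ a (mon k j) ⊗ₜ v x) =
      (galScalar ζ a i : k) • v (loopCoeff k 𝔤 i (mon k j ⊗ₜ x))
    rw [galLaurent_mon, ← TensorProduct.smul_tmul', map_smul]
    by_cases h : i = j
    · subst h
      rw [loopCoeff_mon_self, loopCoeff_mon_self]
    · rw [loopCoeff_mon_of_ne h, loopCoeff_mon_of_ne h, map_zero, smul_zero, smul_zero]
  exact LinearMap.congr_fun h X

theorem lieIterate_apply (f : 𝔤 →ₗ⁅k⁆ 𝔤) (r : ℕ) (x : 𝔤) : lieIterate f r x = f^[r] x := by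
  induction r with
  | zero => rfl
  | succ r ih => rw [Function.iterate_succ_apply', ← ih]; rfl

/-- On an eigenvector of weight `i` the twist `v_a` is the inverse of the scalar by which `a` acts on
`z^i`. -/
theorem multiloopTwist_of_mem {i : Fin n → ℤ} {x : 𝔤} (hx : x ∈ simulEigenspace σ ζ i)
    (a : ∀ j, ZMod (m j)) :
    (galScalar ζ a i : k) • multiloopTwist σ a x = x := by
  suffices ∀ l : List (Fin n),
      (((l.map fun j => (ζ j ^ (a j).val) ^ i j).prod : kˣ) : k) •
        l.foldr (fun j f => (lieIterate (σ j).symm.toLieHom (a j).val).comp f) LieHom.id x = x by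
    have h := this (List.finRange n)
    rwa [← Fin.prod_univ_def] at h
  intro l
  induction l with
  | nil => simp
  | cons j l ih =>
    have h1 (y : 𝔤) (r : ℕ) (hy : y = x) : (((ζ j ^ r) ^ i j : kˣ) : k) •
        lieIterate (σ j).symm.toLieHom r y = x := by
      have e : ((ζ j ^ i j : kˣ) : k) • (σ j).symm x = x := by
        rw [← map_smul, ← hx j, LieEquiv.symm_apply_apply]
      rw [lieIterate_apply, hy, ← zpow_natCast, zpow_comm, zpow_natCast, Units.val_pow_eq_pow_val]
      induction r with
      | zero => simp
      | succ r ih =>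
        rw [Function.iterate_succ_apply', pow_succ', mul_smul, ← map_smul, ih]
        exact e
    rw [List.map_cons, List.prod_cons, List.foldr_cons, Units.val_mul, mul_smul, LieHom.comp_apply,
      ← map_smul]
    exact h1 _ _ ih

theorem multiloopTwist_single (hσ : ∀ j x, (σ j)^[m j] x = x) (j : Fin n) (x : 𝔤) :
    multiloopTwist σ (Pi.single j 1 : ∀ j, ZMod (m j)) x = (σ j).symm x := by
  have h1 : lieIterate (σ j).symm.toLieHom (1 : ZMod (m j)).val x = (σ j).symm x := by
    rw [lieIterate_apply, ZMod.val_one_eq_one_mod]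
    by_cases h : m j = 1
    -- in this case `1 = 0` in `ZMod 1`, but `σ j` is trivial
    · have h2 := hσ j x
      rw [h, Function.iterate_one] at h2
      rw [h, Nat.mod_one, Function.iterate_zero_apply, eq_comm, LieEquiv.symm_apply_eq, h2]
    · rw [Nat.one_mod_eq_one.2 h, Function.iterate_one]
      rfl
  suffices ∀ l : List (Fin n), l.Nodup →
      l.foldr (fun l f => (lieIterate (σ l).symm.toLieHom
        ((Pi.single j 1 : ∀ j, ZMod (m j)) l).val).comp f) LieHom.id x =
      if j ∈ l then (σ j).symm x else x by
    have h := this (List.finRange n) (List.nodup_finRange n)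
    rwa [if_pos (List.mem_finRange j)] at h
  intro l hl
  induction l with
  | nil => simp
  | cons j' l ih =>
    rw [List.nodup_cons] at hl
    rw [List.foldr_cons, LieHom.comp_apply, ih hl.2]
    by_cases h : j' = j
    · subst h
      rw [if_neg hl.1, Pi.single_eq_same, h1, if_pos List.mem_cons_self]
    · rw [Pi.single_eq_of_ne h, ZMod.val_zero]
      simp [lieIterate, Ne.symm h]

/-- The multiloop algebra is the descended algebra of the cocycle `u`. -/
theorem descended_eq_multiloop (hζ : ∀ j, IsPrimitiveRoot (ζ j) (m j))
    (hσ : ∀ j x, (σ j)^[m j] x = x) :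
    descended (galLaurent (m := m) ζ) (multiloopTwist σ) = multiloop σ ζ := by
  ext X
  rw [mem_multiloop_iff]
  have hX : X ∈ descended (galLaurent (m := m) ζ) (multiloopTwist σ) ↔
      ∀ (a : ∀ j, ZMod (m j)) i, (galScalar ζ a i : k) • multiloopTwist σ a (loopCoeff k 𝔤 i X) =
        loopCoeff k 𝔤 i X := by
    refine forall_congr' fun a => ?_
    simp only [← loopCoeff_twist]
    exact ⟨fun h i => congrArg _ h, fun h => loop_ext h⟩
  rw [hX]
  refine ⟨fun h i j => ?_, fun h a i => multiloopTwist_of_mem (h i) a⟩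
  have e := h (Pi.single j 1) i
  rw [galScalar_single hζ, multiloopTwist_single hσ] at e
  conv_lhs => rw [← e]
  rw [map_smul, LieEquiv.apply_symm_apply]

end Multiloop

/-! ### Brackets and lifts in Kassel's Lie algebra -/

section Kassel

variable {k S 𝔤 : Type*} [Field k] [CharZero k] [CommRing S] [Algebra k S]
  [LieRing 𝔤] [LieAlgebra k 𝔤]

variable (k S 𝔤) in
/-- Kassel's cocycle, with values in `Ω_S / dS` itself. -/
def kasselPairing : (S ⊗[k] 𝔤) →ₗ[k] (S ⊗[k] 𝔤) →ₗ[k] OmegaModExact k S :=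
  (kasselForm k S 𝔤).compr₂
    (TrivialLieModule.equiv k (S ⊗[k] 𝔤) (OmegaModExact k S)).toLinearMap

theorem kasselPairing_tmul (s t : S) (x y : 𝔤) :
    kasselPairing k S 𝔤 (s ⊗ₜ x) (t ⊗ₜ y) = killingForm k 𝔤 x y • adb k S s t := by
  simp only [kasselPairing, LinearMap.compr₂_apply, kasselForm_tmul]
  exact LinearEquiv.apply_symm_apply _ _

theorem lie_kassel_mk (X Y : S ⊗[k] 𝔤) (z w : OmegaModExact k S) :
    ⁅Kassel.mk X z, Kassel.mk Y w⁆ = Kassel.mk ⁅X, Y⁆ (kasselPairing k S 𝔤 X Y) :=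
  Kassel.lie_mk X Y z w

variable (k S 𝔤) in
/-- The decomposition of Kassel's Lie algebra as a direct sum of vector spaces. -/
def kasselEquiv : Kassel k S 𝔤 ≃ₗ[k] (S ⊗[k] 𝔤) × OmegaModExact k S where
  toFun x := (Kassel.proj x, Kassel.snd x)
  invFun p := Kassel.mk p.1 p.2
  map_add' x y := Prod.ext (map_add _ _ _) (by simp [Kassel.snd])
  map_smul' c x := Prod.ext (map_smul _ _ _) (by simp [Kassel.snd])
  left_inv _ := rfl
  right_inv _ := rfl

theorem kassel_mk_proj_snd (x : Kassel k S 𝔤) : Kassel.mk (Kassel.proj x) (Kassel.snd x) = x := rfl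

theorem kassel_mk_add (X Y : S ⊗[k] 𝔤) (z w : OmegaModExact k S) :
    Kassel.mk (X + Y) (z + w) = Kassel.mk X z + Kassel.mk Y w :=
  map_add (kasselEquiv k S 𝔤).symm (X, z) (Y, w)

variable (k S 𝔤) in
/-- The inclusion of `𝔤_S` as a subspace of Kassel's Lie algebra. -/
def kasselInl : S ⊗[k] 𝔤 →ₗ[k] Kassel k S 𝔤 :=
  (kasselEquiv k S 𝔤).symm.toLinearMap ∘ₗ LinearMap.inl k _ _

variable (k S 𝔤) in
/-- The inclusion of `Ω_S / dS` as a subspace of Kassel's Lie algebra. -/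
def kasselInr : OmegaModExact k S →ₗ[k] Kassel k S 𝔤 :=
  (kasselEquiv k S 𝔤).symm.toLinearMap ∘ₗ LinearMap.inr k _ _

theorem kasselInl_apply (X : S ⊗[k] 𝔤) : kasselInl k S 𝔤 X = Kassel.mk X 0 := rfl

theorem kasselInr_apply (z : OmegaModExact k S) : kasselInr k S 𝔤 z = Kassel.mk 0 z := rfl

theorem kassel_mk_eq (X : S ⊗[k] 𝔤) (z : OmegaModExact k S) :
    Kassel.mk X z = kasselInl k S 𝔤 X + kasselInr k S 𝔤 z := by
  rw [kasselInl_apply, kasselInr_apply, ← kassel_mk_add, add_zero, zero_add]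

theorem lie_kasselInl (X Y : S ⊗[k] 𝔤) :
    ⁅kasselInl k S 𝔤 X, kasselInl k S 𝔤 Y⁆ =
      kasselInl k S 𝔤 ⁅X, Y⁆ + kasselInr k S 𝔤 (kasselPairing k S 𝔤 X Y) := by
  rw [← kassel_mk_eq]
  exact lie_kassel_mk X Y 0 0

theorem mem_center_of_proj_eq_zero {x : Kassel k S 𝔤} (hx : Kassel.proj x = 0) :
    x ∈ LieAlgebra.center k (Kassel k S 𝔤) := by
  refine (LieModule.mem_maxTrivSubmodule k _ _ x).2 fun y => ?_
  rw [← kassel_mk_proj_snd x, ← kassel_mk_proj_snd y, hx, lie_kassel_mk, lie_zero, map_zero]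
  exact map_zero (kasselEquiv k S 𝔤).symm

/-- Kassel's Lie algebra is perfect: `[s ⊗ x, 1 ⊗ y] = s ⊗ [x, y]` as `s d1 = 0`, so all of `𝔤_S`
consists of sums of brackets, and the centre is then obtained from `(x | y) s dt`. -/
theorem isPerfect_kassel [LieAlgebra.IsSimple k 𝔤] [FiniteDimensional k 𝔤] :
    IsPerfect k (Kassel k S 𝔤) := by
  intro ξ
  set W := Submodule.span k (Set.range fun p : Kassel k S 𝔤 × Kassel k S 𝔤 => ⁅p.1, p.2⁆)
  have hlie (x y : Kassel k S 𝔤) : ⁅x, y⁆ ∈ W := Submodule.subset_span ⟨(x, y), rfl⟩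
  have h1 (s : S) : adb k S s 1 = 0 := by
    rw [adb_apply, Derivation.map_one_eq_zero, smul_zero, map_zero]
  have h2 : ⊤ ≤ W.comap (kasselInl k S 𝔤) := by
    rw [← TensorProduct.span_tmul_eq_top, Submodule.span_le]
    rintro _ ⟨s, x, rfl⟩
    change s ⊗ₜ[k] x ∈ W.comap (kasselInl k S 𝔤)
    induction isPerfect_of_isSimple (k := k) x using Submodule.span_induction with
    | zero => rw [TensorProduct.tmul_zero]; exact zero_mem _
    | add x y _ _ hx hy => rw [TensorProduct.tmul_add]; exact add_mem hx hy
    | smul c x _ hx => rw [TensorProduct.tmul_smul]; exact Submodule.smul_mem _ c hx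
    | mem _ hx =>
      obtain ⟨⟨x, y⟩, rfl⟩ := hx
      have e := hlie (kasselInl k S 𝔤 (s ⊗ₜ x)) (kasselInl k S 𝔤 (1 ⊗ₜ y))
      rwa [lie_kasselInl, kasselPairing_tmul, h1, smul_zero, map_zero, add_zero,
        LieAlgebra.ExtendScalars.bracket_tmul, mul_one] at e
  obtain ⟨x, y, hxy⟩ : ∃ x y, killingForm k 𝔤 x y ≠ 0 := by
    by_contra! h
    refine LieAlgebra.IsSimple.non_abelian k (L := 𝔤) ⟨fun x y => ?_⟩
    rw [(LieAlgebra.IsKilling.killingForm_nondegenerate k 𝔤).1 x (h x), zero_lie]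
  have h3 : W.mkQ ∘ₗ kasselInr k S 𝔤 = 0 := by
    refine omegaModExact_linearMap_ext fun s t => (Submodule.Quotient.mk_eq_zero _).2 ?_
    have e := sub_mem (hlie (kasselInl k S 𝔤 (s ⊗ₜ x)) (kasselInl k S 𝔤 (t ⊗ₜ y)))
      (h2 (Submodule.mem_top (x := ⁅s ⊗ₜ[k] x, t ⊗ₜ[k] y⁆)))
    rw [lie_kasselInl, add_sub_cancel_left, kasselPairing_tmul, map_smul] at e
    exact (Submodule.smul_mem_iff _ hxy).1 e
  rw [← kassel_mk_proj_snd ξ, kassel_mk_eq]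
  exact add_mem (h2 Submodule.mem_top)
    ((Submodule.Quotient.mk_eq_zero _).1 (LinearMap.congr_fun h3 (Kassel.snd ξ)))

theorem kasselPairing_constLoop (v : 𝔤 ≃ₗ⁅k⁆ 𝔤) (X Y : S ⊗[k] 𝔤) :
    kasselPairing k S 𝔤 (constLoop v.toLieHom X) (constLoop v.toLieHom Y) =
      kasselPairing k S 𝔤 X Y := by
  induction X using TensorProduct.induction_on with
  | zero => simp
  | add X X' h h' => simp only [map_add, LinearMap.add_apply, h, h']
  | tmul s x =>
    induction Y using TensorProduct.induction_on with
    | zero => simp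
    | add Y Y' h h' => simp only [map_add, h, h']
    | tmul t y =>
      rw [constLoop_tmul, constLoop_tmul, kasselPairing_tmul, kasselPairing_tmul]
      congr 1
      exact LieAlgebra.killingForm_of_equiv_apply v x y

theorem constLoop_constLoop (v w : 𝔤 →ₗ⁅k⁆ 𝔤) (h : ∀ x, v (w x) = x) (X : S ⊗[k] 𝔤) :
    constLoop v (constLoop w X) = X := by
  induction X using TensorProduct.induction_on with
  | zero => simp
  | add X X' h h' => simp only [map_add, h, h']
  | tmul s x => rw [constLoop_tmul, constLoop_tmul, h]

/-- The lift `(v ⊗ id) ⊕ id` of `v ⊗ id` to Kassel's Lie algebra; it is a homomorphism because the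
Killing form is invariant under automorphisms. -/
def kasselLift (v : 𝔤 ≃ₗ⁅k⁆ 𝔤) : Kassel k S 𝔤 ≃ₗ⁅k⁆ Kassel k S 𝔤 where
  toFun x := Kassel.mk (constLoop v.toLieHom (Kassel.proj x)) (Kassel.snd x)
  invFun x := Kassel.mk (constLoop v.symm.toLieHom (Kassel.proj x)) (Kassel.snd x)
  map_add' x y := by
    rw [← kassel_mk_add, ← map_add, ← map_add]
    exact congrArg _ (congrArg Prod.snd (map_add (kasselEquiv k S 𝔤) x y))
  map_smul' c x := by
    rw [map_smul, map_smul]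
    exact (congrArg _ (congrArg Prod.snd (map_smul (kasselEquiv k S 𝔤) c x))).trans
      (map_smul (kasselEquiv k S 𝔤).symm c (_, _))
  map_lie' {x y} := by
    change Kassel.mk _ _ = ⁅Kassel.mk _ _, Kassel.mk _ _⁆
    rw [lie_kassel_mk, kasselPairing_constLoop, LieHom.map_lie, LieHom.map_lie]
    congr 1
    conv_lhs => rw [← kassel_mk_proj_snd x, ← kassel_mk_proj_snd y, lie_kassel_mk]
    rfl
  left_inv x := by
    change Kassel.mk (constLoop v.symm.toLieHom (constLoop v.toLieHom (Kassel.proj x)))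
      (Kassel.snd x) = x
    rw [constLoop_constLoop _ _ v.symm_apply_apply]
    rfl
  right_inv x := by
    change Kassel.mk (constLoop v.toLieHom (constLoop v.symm.toLieHom (Kassel.proj x)))
      (Kassel.snd x) = x
    rw [constLoop_constLoop _ _ v.apply_symm_apply]
    rfl

theorem isLift_kasselLift (v : 𝔤 ≃ₗ⁅k⁆ 𝔤) :
    IsLift (S := S) (constLoop v.toLieHom) (kasselLift v) := fun _ => rfl

theorem IsLift.unique [LieAlgebra.IsSimple k 𝔤] [FiniteDimensional k 𝔤]
    {θ : S ⊗[k] 𝔤 →ₗ⁅k⁆ S ⊗[k] 𝔤} {θ₁ θ₂ : Kassel k S 𝔤 ≃ₗ⁅k⁆ Kassel k S 𝔤}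
    (h₁ : IsLift θ θ₁) (h₂ : IsLift θ θ₂) : θ₁ = θ₂ := by
  have h := isPerfect_kassel.eq_of_sub_mem_center θ₁.toLieHom θ₂.toLieHom fun x => by
    refine mem_center_of_proj_eq_zero ?_
    rw [map_sub, sub_eq_zero]
    exact (h₁ x).trans (h₂ x).symm
  ext x
  exact LieHom.congr_fun h x

end Kassel

section Twist

variable {k 𝔤 : Type*} [Field k] [LieRing 𝔤] [LieAlgebra k 𝔤] {n : ℕ} {m : Fin n → ℕ}

theorem exists_equiv_lieIterate (f : 𝔤 ≃ₗ⁅k⁆ 𝔤) (r : ℕ) :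
    ∃ v : 𝔤 ≃ₗ⁅k⁆ 𝔤, lieIterate f.toLieHom r = v.toLieHom := by
  induction r with
  | zero => exact ⟨LieEquiv.refl, rfl⟩
  | succ r ih =>
    obtain ⟨v, hv⟩ := ih
    refine ⟨v.trans f, ?_⟩
    rw [lieIterate, hv]
    rfl

theorem exists_equiv_multiloopTwist (σ : Fin n → (𝔤 ≃ₗ⁅k⁆ 𝔤)) (a : ∀ j, ZMod (m j)) :
    ∃ v : 𝔤 ≃ₗ⁅k⁆ 𝔤, multiloopTwist σ a = v.toLieHom := by
  unfold multiloopTwist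
  induction List.finRange n with
  | nil => exact ⟨LieEquiv.refl, rfl⟩
  | cons j l ih =>
    obtain ⟨v, hv⟩ := ih
    obtain ⟨v', hv'⟩ := exists_equiv_lieIterate (σ j).symm (a j).val
    refine ⟨v.trans v', ?_⟩
    rw [List.foldr_cons, hv, hv']
    rfl

end Twist

/-! ### Homogeneous elements of the multiloop algebra -/

section MultiloopLemmas

variable {k 𝔤 : Type*} [Field k] [LieRing 𝔤] [LieAlgebra k 𝔤] {n : ℕ} {m : Fin n → ℕ}
  {ζ : Fin n → kˣ} {σ : Fin n → (𝔤 ≃ₗ⁅k⁆ 𝔤)}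

theorem lie_mon_tmul (i j : Fin n → ℤ) (x y : 𝔤) :
    ⁅mon k i ⊗ₜ[k] x, mon k j ⊗ₜ[k] y⁆ = mon k (i + j) ⊗ₜ[k] ⁅x, y⁆ := by
  rw [LieAlgebra.ExtendScalars.bracket_tmul, mon_mul_mon]

theorem multiloop_linearMap_ext {V : Type*} [AddCommGroup V] [Module k V]
    {f g : multiloop σ ζ →ₗ[k] V}
    (h : ∀ i x (hx : x ∈ simulEigenspace σ ζ i),
      f ⟨mon k i ⊗ₜ x, mon_tmul_mem_multiloop hx⟩ = g ⟨mon k i ⊗ₜ x, mon_tmul_mem_multiloop hx⟩) :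
    f = g := by
  refine LinearMap.ext fun X => ?_
  obtain ⟨s, hs⟩ := loop_eq_sum (X : Laurent k n ⊗[k] 𝔤)
  have hX : X = ∑ i ∈ s, ⟨mon k i ⊗ₜ loopCoeff k 𝔤 i (X : Laurent k n ⊗[k] 𝔤),
      mon_tmul_mem_multiloop (mem_multiloop_iff.1 X.2 i)⟩ := by
    refine Subtype.ext (hs.trans ?_)
    rw [AddSubmonoidClass.coe_finsetSum]
  rw [hX, map_sum, map_sum]
  exact Finset.sum_congr rfl fun i _ => h i _ (mem_multiloop_iff.1 X.2 i)

theorem loopCoeff_lie_mon (i j : Fin n → ℤ) (y : 𝔤) (X : Laurent k n ⊗[k] 𝔤) :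
    loopCoeff k 𝔤 (j + i) ⁅mon k j ⊗ₜ[k] y, X⁆ = ⁅y, loopCoeff k 𝔤 i X⁆ := by
  have h : loopCoeff k 𝔤 (j + i) ∘ₗ (LieModule.toEnd k (Laurent k n ⊗[k] 𝔤) (Laurent k n ⊗[k] 𝔤)
      (mon k j ⊗ₜ[k] y)) = (LieModule.toEnd k 𝔤 𝔤 y) ∘ₗ loopCoeff k 𝔤 i := by
    refine loop_linearMap_ext fun l x => ?_
    change loopCoeff k 𝔤 (j + i) ⁅mon k j ⊗ₜ[k] y, mon k l ⊗ₜ[k] x⁆ =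
      ⁅y, loopCoeff k 𝔤 i (mon k l ⊗ₜ[k] x)⁆
    rw [lie_mon_tmul]
    by_cases hl : i = l
    · subst hl
      rw [loopCoeff_mon_self, loopCoeff_mon_self]
    · rw [loopCoeff_mon_of_ne hl, loopCoeff_mon_of_ne (by simpa using hl), lie_zero]
  exact LinearMap.congr_fun h X

theorem mem_simulEigenspace_iff_of_gradeClass_eq (hm : ∀ j, 0 < m j)
    (hζ : ∀ j, IsPrimitiveRoot (ζ j) (m j)) {i i' : Fin n → ℤ}
    (h : gradeClass m i = gradeClass m i') {x : 𝔤} :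
    x ∈ simulEigenspace σ ζ i ↔ x ∈ simulEigenspace σ ζ i' := by
  rw [← eigenGrading_gradeClass hm hζ, ← eigenGrading_gradeClass hm hζ, h]

end MultiloopLemmas

/-! ### Cocycles of the multiloop algebra -/

section Cocycles

variable {k 𝔤 : Type*} [Field k] [IsAlgClosed k] [CharZero k] [LieRing 𝔤] [LieAlgebra k 𝔤]
  [FiniteDimensional k 𝔤] [LieAlgebra.IsSimple k 𝔤] {n : ℕ} {m : Fin n → ℕ}
  {ζ : Fin n → kˣ} {σ : Fin n → (𝔤 ≃ₗ⁅k⁆ 𝔤)}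

/-- Every `2`-cocycle of the multiloop algebra becomes a coboundary on Kassel's Lie algebra. -/
theorem exists_functional_of_cocycle (hm : ∀ j, 0 < m j) (hζ : ∀ j, IsPrimitiveRoot (ζ j) (m j))
    (hσ : ∀ j x, (σ j)^[m j] x = x) (hcomm : ∀ i j x, σ i (σ j x) = σ j (σ i x))
    (ψ : multiloop σ ζ →ₗ[k] multiloop σ ζ →ₗ[k] k) (hψ : ∀ X, ψ X X = 0)
    (hψ' : ∀ X Y Z, ψ X ⁅Y, Z⁆ = ψ ⁅X, Y⁆ Z + ψ Y ⁅X, Z⁆) :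
    ∃ F : Kassel k (Laurent k n) 𝔤 →ₗ[k] k, ∀ x y (hx : Kassel.proj x ∈ multiloop σ ζ)
      (hy : Kassel.proj y ∈ multiloop σ ζ), F ⁅x, y⁆ = ψ ⟨_, hx⟩ ⟨_, hy⟩ := by
  have (j : Fin n) : NeZero (m j) := ⟨(hm j).ne'⟩
  let := eigenGradedLieAlgebra hm hζ hσ hcomm
  have hE (i : Fin n → ℤ) := eigenGrading_gradeClass (σ := σ) hm hζ i
  -- the embedding `x ↦ z^i ⊗ x` of the component of degree `i`, extended by zero to `𝔤`
  let inj (i : Fin n → ℤ) : 𝔤 →ₗ[k] multiloop σ ζ :=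
    LinearMap.codRestrict (multiloop σ ζ).toSubmodule
      (monomialLoop 𝔤 i ∘ₗ gradedProj (eigenGrading m ζ σ) (gradeClass m i)) fun x => by
        refine mon_tmul_mem_multiloop ?_
        rw [← hE]
        exact gradedProj_mem _ _ _
  have hinj (i : Fin n → ℤ) (x : 𝔤) (hx : x ∈ simulEigenspace σ ζ i) :
      inj i x = ⟨mon k i ⊗ₜ x, mon_tmul_mem_multiloop hx⟩ := by
    refine Subtype.ext ?_
    change mon k i ⊗ₜ gradedProj (eigenGrading m ζ σ) (gradeClass m i) x = _
    rw [gradedProj_of_mem (by rwa [hE])]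
  have hinj_lie (i j : Fin n → ℤ) (x y : 𝔤) (hx : x ∈ simulEigenspace σ ζ i)
      (hy : y ∈ simulEigenspace σ ζ j) : inj (i + j) ⁅x, y⁆ = ⁅inj i x, inj j y⁆ := by
    rw [hinj _ _ (lie_mem_simulEigenspace hx hy), hinj _ _ hx, hinj _ _ hy]
    exact Subtype.ext (lie_mon_tmul i j x y).symm
  have hψskew (X Y : multiloop σ ζ) : ψ X Y = -ψ Y X := by
    have h := hψ (X + Y)
    rw [map_add, map_add, LinearMap.add_apply, LinearMap.add_apply, hψ, hψ, zero_add,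
      add_zero] at h
    linear_combination h
  obtain ⟨w, θ, hθ, hb⟩ := exists_of_graded_cocycle (E := eigenGrading m ζ σ) (gradeClass m)
    gradeClass_surjective (fun i j => ψ.compl₁₂ (inj i) (inj j))
    (fun i j x y _ _ => hψskew _ _)
    (fun i j l x y z hx hy hz => by
      rw [hE] at hx hy hz
      simp only [LinearMap.compl₁₂_apply]
      rw [hinj_lie _ _ _ _ hy hz, hinj_lie _ _ _ _ hx hy, hinj_lie _ _ _ _ hx hz, hψ'])
  obtain ⟨f₂, hf₂⟩ := exists_functional_omegaModExact θ hθ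
  let f₁ : Laurent k n ⊗[k] 𝔤 →ₗ[k] k :=
    TensorProduct.lift (ofMon fun mu => killingForm k 𝔤 (w mu))
  have hf₁ (i : Fin n → ℤ) (x : 𝔤) : f₁ (mon k i ⊗ₜ x) = killingForm k 𝔤 (w i) x := by
    rw [TensorProduct.lift.tmul, ofMon_mon]
  let F : Kassel k (Laurent k n) 𝔤 →ₗ[k] k :=
    (f₁.coprod f₂) ∘ₗ (kasselEquiv k (Laurent k n) 𝔤).toLinearMap
  have hF (X : Laurent k n ⊗[k] 𝔤) (ω : OmegaModExact k (Laurent k n)) :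
      F (Kassel.mk X ω) = f₁ X + f₂ ω := rfl
  let B : multiloop σ ζ →ₗ[k] multiloop σ ζ →ₗ[k] k :=
    ((LieModule.toEnd k (Laurent k n ⊗[k] 𝔤) (Laurent k n ⊗[k] 𝔤) :
        Laurent k n ⊗[k] 𝔤 →ₗ[k] Laurent k n ⊗[k] 𝔤 →ₗ[k] Laurent k n ⊗[k] 𝔤).compr₂ f₁ +
      (kasselPairing k (Laurent k n) 𝔤).compr₂ f₂).compl₁₂
        (multiloop σ ζ).toSubmodule.subtype (multiloop σ ζ).toSubmodule.subtype
  have hB : B = ψ := by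
    refine multiloop_linearMap_ext fun i x hx => multiloop_linearMap_ext fun j y hy => ?_
    have h := hb i j x y (by rwa [hE]) (by rwa [hE])
    rw [LinearMap.compl₁₂_apply, hinj _ _ hx, hinj _ _ hy] at h
    rw [h]
    change f₁ ⁅mon k i ⊗ₜ[k] x, mon k j ⊗ₜ[k] y⁆ +
      f₂ (kasselPairing k (Laurent k n) 𝔤 (mon k i ⊗ₜ[k] x) (mon k j ⊗ₜ[k] y)) = _
    rw [lie_mon_tmul, hf₁, kasselPairing_tmul, map_smul, hf₂, smul_eq_mul, mul_comm]
  refine ⟨F, fun x y hx hy => ?_⟩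
  rw [← hB]
  conv_lhs => rw [← kassel_mk_proj_snd x, ← kassel_mk_proj_snd y, lie_kassel_mk, hF]
  rfl

end Cocycles

/-! ### The descended central extension -/

section Hat

variable {k 𝔤 : Type*} [Field k] [IsAlgClosed k] [CharZero k] [LieRing 𝔤] [LieAlgebra k 𝔤]
  [FiniteDimensional k 𝔤] [LieAlgebra.IsSimple k 𝔤] {n : ℕ} {m : Fin n → ℕ}
  {ζ : Fin n → kˣ} {σ : Fin n → (𝔤 ≃ₗ⁅k⁆ 𝔤)}
  {uhat : (∀ j, ZMod (m j)) → (Kassel k (Laurent k n) 𝔤 ≃ₗ⁅k⁆ Kassel k (Laurent k n) 𝔤)}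

/-- `L_û` is the sum of the multiloop algebra and of the image of `Ω_R / dR`. -/
theorem mem_descendedHat_iff (hm : ∀ j, 0 < m j) (hζ : ∀ j, IsPrimitiveRoot (ζ j) (m j))
    (hσ : ∀ j x, (σ j)^[m j] x = x) (hu : ∀ a, IsLift (constLoop (multiloopTwist σ a)) (uhat a))
    (x : Kassel k (Laurent k n) 𝔤) :
    x ∈ descendedHat (galLaurent ζ) uhat ↔
      Kassel.proj x ∈ multiloop σ ζ ∧
        ∃ ω, mapOmegaModExact (laurentIncl k m) ω = Kassel.snd x := by
  have huhat (a : ∀ j, ZMod (m j)) : uhat a (galKassel (galLaurent ζ a) x) =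
      Kassel.mk (constLoop (multiloopTwist σ a) (galLoop (galLaurent ζ a) (Kassel.proj x)))
        (mapOmegaModExact (galLaurent ζ a) (Kassel.snd x)) := by
    obtain ⟨v, hv⟩ := exists_equiv_multiloopTwist σ a
    rw [(hu a).unique (hv ▸ isLift_kasselLift v), hv]
    rfl
  have h1 : x ∈ descendedHat (galLaurent ζ) uhat ↔
      Kassel.proj x ∈ descended (galLaurent (m := m) ζ) (multiloopTwist σ) ∧
        ∀ a : ∀ j, ZMod (m j), mapOmegaModExact (galLaurent ζ a) (Kassel.snd x) =
          Kassel.snd x := by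
    refine (forall_congr' fun a => ?_).trans forall_and
    change uhat a (galKassel (galLaurent ζ a) x) = x ↔ _
    rw [huhat]
    refine ⟨fun h => ⟨congrArg Kassel.proj h, congrArg Kassel.snd h⟩, fun h => ?_⟩
    rw [h.2, ← kassel_mk_proj_snd x]
    exact congrArg (Kassel.mk · _) h.1
  rw [h1, descended_eq_multiloop hζ hσ]
  refine and_congr_right fun _ => ⟨exists_mapOmegaModExact_laurentIncl_eq hm hζ, ?_⟩
  rintro ⟨ω, hω⟩ a
  rw [← hω]
  have h : mapOmegaModExact (galLaurent ζ a) ∘ₗ mapOmegaModExact (laurentIncl k m) =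
      mapOmegaModExact (laurentIncl k m) := by
    refine omegaModExact_linearMap_ext fun r r' => ?_
    rw [LinearMap.comp_apply, mapOmegaModExact_adb, mapOmegaModExact_adb,
      galLaurent_laurentIncl hζ, galLaurent_laurentIncl hζ]
  exact LinearMap.congr_fun h ω

/-- There are simultaneous eigenvectors of opposite degrees on which the Killing form does not
vanish. -/
theorem exists_killingForm_ne_zero (hm : ∀ j, 0 < m j) (hζ : ∀ j, IsPrimitiveRoot (ζ j) (m j))
    (hσ : ∀ j x, (σ j)^[m j] x = x) (hcomm : ∀ i j x, σ i (σ j x) = σ j (σ i x)) :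
    ∃ i, ∃ x ∈ simulEigenspace σ ζ i, ∃ y ∈ simulEigenspace σ ζ (-i), killingForm k 𝔤 x y ≠ 0 := by
  let := eigenGradedLieAlgebra hm hζ hσ hcomm
  have hE (i : Fin n → ℤ) := eigenGrading_gradeClass (σ := σ) hm hζ i
  by_contra! hcon
  have h (i j : Fin n → ℤ) (x y : 𝔤) (hx : x ∈ simulEigenspace σ ζ i)
      (hy : y ∈ simulEigenspace σ ζ j) : killingForm k 𝔤 x y = 0 := by
    by_contra hne
    refine hne (hcon i x hx y fun l => ?_)
    -- by invariance under `σ l`, the degrees are opposite modulo `m l`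
    have e : killingForm k 𝔤 (σ l x) (σ l y) = killingForm k 𝔤 x y :=
      LieAlgebra.killingForm_of_equiv_apply (σ l) x y
    rw [hx l, hy l, map_smul, map_smul, LinearMap.smul_apply, smul_smul, smul_eq_mul] at e
    have e' : ζ l ^ j l * ζ l ^ i l = 1 :=
      Units.ext (mul_right_cancel₀ hne (by rw [Units.val_mul, e, Units.val_one, one_mul]))
    rw [hy l, Pi.neg_apply, zpow_neg, eq_inv_of_mul_eq_one_left e']
  refine LieAlgebra.IsSimple.non_abelian k (L := 𝔤) ⟨fun x y => ?_⟩
  suffices x = 0 by rw [this, zero_lie]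
  refine (LieAlgebra.IsKilling.killingForm_nondegenerate k 𝔤).1 x fun y => ?_
  induction x using graded_induction (eigenGrading m ζ σ) with
  | zero => simp
  | add x x' h h' => rw [map_add, LinearMap.add_apply, h, h', add_zero]
  | mem a x hx =>
    induction y using graded_induction (eigenGrading m ζ σ) with
    | zero => simp
    | add y y' h h' => rw [map_add, h, h', add_zero]
    | mem b y hy =>
      obtain ⟨i, rfl⟩ := gradeClass_surjective a
      obtain ⟨j, rfl⟩ := gradeClass_surjective b
      exact h i j x y (by rwa [← hE]) (by rwa [← hE])

/-- The descended central extension `L_û` is perfect. -/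
theorem isPerfect_descendedHat (hm : ∀ j, 0 < m j) (hζ : ∀ j, IsPrimitiveRoot (ζ j) (m j))
    (hσ : ∀ j x, (σ j)^[m j] x = x) (hcomm : ∀ i j x, σ i (σ j x) = σ j (σ i x))
    (hu : ∀ a, IsLift (constLoop (multiloopTwist σ a)) (uhat a)) :
    IsPerfect k (descendedHat (galLaurent ζ) uhat) := by
  let := eigenGradedLieAlgebra hm hζ hσ hcomm
  have hE (i : Fin n → ℤ) := eigenGrading_gradeClass (σ := σ) hm hζ i
  have hH := mem_descendedHat_iff hm hζ hσ hu
  set H := descendedHat (galLaurent ζ) uhat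
  refine isPerfect_of_le_span H ?_
  set W := Submodule.span k {z | ∃ x ∈ H, ∃ y ∈ H, ⁅x, y⁆ = z}
  have hW {x y : Kassel k (Laurent k n) 𝔤} (hx : x ∈ H) (hy : y ∈ H) : ⁅x, y⁆ ∈ W :=
    Submodule.subset_span ⟨x, hx, y, hy, rfl⟩
  have hmon {i : Fin n → ℤ} {x : 𝔤} (hx : x ∈ simulEigenspace σ ζ i) :
      kasselInl k (Laurent k n) 𝔤 (mon k i ⊗ₜ x) ∈ H :=
    (hH _).2 ⟨mon_tmul_mem_multiloop hx, 0, map_zero _⟩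
  -- the centre is spanned by differences of brackets with the same component in `𝔤_S`
  have hcen (ω : OmegaModExact k (Laurent k n)) :
      kasselInr k (Laurent k n) 𝔤 (mapOmegaModExact (laurentIncl k m) ω) ∈ W := by
    suffices W.mkQ ∘ₗ kasselInr k (Laurent k n) 𝔤 ∘ₗ mapOmegaModExact (laurentIncl k m) = 0 from
      (Submodule.Quotient.mk_eq_zero _).1 (LinearMap.congr_fun this ω)
    obtain ⟨i, x, hx, y, hy, hxy⟩ := exists_killingForm_ne_zero hm hζ hσ hcomm
    refine omegaModExact_linearMap_ext fun r r' => ?_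
    suffices (adb k (Laurent k n)).compr₂
        (W.mkQ ∘ₗ kasselInr k (Laurent k n) 𝔤 ∘ₗ mapOmegaModExact (laurentIncl k m)) = 0 from
      LinearMap.congr_fun (LinearMap.congr_fun this r) r'
    refine laurent_linearMap_ext fun c => laurent_linearMap_ext fun c' => ?_
    refine (Submodule.Quotient.mk_eq_zero _).2 ?_
    rw [LinearMap.comp_apply, mapOmegaModExact_adb]
    have hshift (i c : Fin n → ℤ) (x : 𝔤) (hx : x ∈ simulEigenspace σ ζ i) :
        kasselInl k (Laurent k n) 𝔤 ((mon k i * laurentIncl k m (mon k c)) ⊗ₜ x) ∈ H := by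
      rw [laurentIncl_mon, mon_mul_mon]
      refine hmon ((mem_simulEigenspace_iff_of_gradeClass_eq hm hζ ?_).1 hx)
      rw [map_add, gradeClass_laurentIncl, add_zero]
    have e := sub_mem (hW (hshift i c x hx) (hshift (-i) c' y hy))
      (hW (hshift i (c + c') x hx) (hmon hy))
    rw [lie_kasselInl, lie_kasselInl, kasselPairing_tmul, kasselPairing_tmul,
      LieAlgebra.ExtendScalars.bracket_tmul, LieAlgebra.ExtendScalars.bracket_tmul,
      ← mon_mul_mon c c', map_mul (laurentIncl k m)] at e
    have hcomm' (p q a b : Laurent k n) : p * a * (q * b) = p * (a * b) * q := by ring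
    rw [hcomm', add_sub_add_left_eq_sub, ← map_sub, ← smul_sub,
      adb_mul_sub _ _ _ _ (by rw [mon_mul_mon, add_neg_cancel, mon_zero]), map_smul] at e
    exact (Submodule.smul_mem_iff _ hxy).1 e
  have hlie {i j : Fin n → ℤ} {x y : 𝔤} (hx : x ∈ simulEigenspace σ ζ i)
      (hy : y ∈ simulEigenspace σ ζ j) :
      kasselInl k (Laurent k n) 𝔤 (mon k (i + j) ⊗ₜ ⁅x, y⁆) ∈ W := by
    have e := hW (hmon hx) (hmon hy)
    obtain ⟨-, ω, hω⟩ := (hH _).1 (H.lie_mem (hmon hx) (hmon hy))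
    rw [lie_kasselInl, lie_mon_tmul, ← kassel_mk_eq, Kassel.snd_mk] at hω
    rw [lie_kasselInl, lie_mon_tmul, ← hω] at e
    exact (Submodule.add_mem_iff_left _ (hcen ω)).1 e
  -- every element of an eigenspace is a sum of brackets of eigenvectors, as `𝔤` is perfect
  have hproj (i : Fin n → ℤ) (x : 𝔤) : kasselInl k (Laurent k n) 𝔤
      (mon k i ⊗ₜ gradedProj (eigenGrading m ζ σ) (gradeClass m i) x) ∈ W := by
    induction isPerfect_of_isSimple (k := k) x using Submodule.span_induction with
    | zero => rw [map_zero, TensorProduct.tmul_zero, map_zero]; exact zero_mem _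
    | add x y _ _ hx hy =>
      rw [map_add, TensorProduct.tmul_add, map_add]
      exact add_mem hx hy
    | smul c x _ hx =>
      rw [map_smul, TensorProduct.tmul_smul, map_smul]
      exact Submodule.smul_mem _ c hx
    | mem _ hx =>
      obtain ⟨⟨x, y⟩, rfl⟩ := hx
      change kasselInl k (Laurent k n) 𝔤
        (mon k i ⊗ₜ gradedProj (eigenGrading m ζ σ) (gradeClass m i) ⁅x, y⁆) ∈ W
      induction x using graded_induction (eigenGrading m ζ σ) with
      | zero => rw [zero_lie, map_zero, TensorProduct.tmul_zero, map_zero]; exact zero_mem _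
      | add x x' h h' =>
        rw [add_lie, map_add, TensorProduct.tmul_add, map_add]
        exact add_mem h h'
      | mem a x hx =>
        induction y using graded_induction (eigenGrading m ζ σ) with
        | zero => rw [lie_zero, map_zero, TensorProduct.tmul_zero, map_zero]; exact zero_mem _
        | add y y' h h' =>
          rw [lie_add, map_add, TensorProduct.tmul_add, map_add]
          exact add_mem h h'
        | mem b y hy =>
          by_cases hab : a + b = gradeClass m i
          · obtain ⟨l, rfl⟩ := gradeClass_surjective a
            rw [gradedProj_of_mem (hab ▸ lie_mem_graded hx hy)]
            have hb : b = gradeClass m (i - l) := by rw [map_sub, ← hab, add_sub_cancel_left]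
            rw [hb, hE] at hy
            rw [hE] at hx
            have := hlie hx hy
            rwa [add_sub_cancel] at this
          · rw [gradedProj_of_mem_ne (lie_mem_graded hx hy) hab, TensorProduct.tmul_zero, map_zero]
            exact zero_mem _
  intro ξ hξ
  obtain ⟨hX, ω, hω⟩ := (hH ξ).1 hξ
  rw [← kassel_mk_proj_snd ξ, kassel_mk_eq, ← hω]
  refine add_mem ?_ (hcen ω)
  obtain ⟨s, hs⟩ := loop_eq_sum (Kassel.proj ξ)
  rw [hs, map_sum]
  refine sum_mem fun i _ => ?_
  have h := hproj i (loopCoeff k 𝔤 i (Kassel.proj ξ))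
  rwa [gradedProj_of_mem (by rw [hE]; exact mem_multiloop_iff.1 hX i)] at h

theorem isCentralExtension_descendedProj (hm : ∀ j, 0 < m j)
    (hζ : ∀ j, IsPrimitiveRoot (ζ j) (m j)) (hσ : ∀ j x, (σ j)^[m j] x = x)
    (hu : ∀ a, IsLift (constLoop (multiloopTwist σ a)) (uhat a)) :
    IsCentralExtension (descendedProj (galLaurent ζ) (multiloopTwist σ) uhat hu) := by
  constructor
  · rintro ⟨X, hX⟩
    have hX' : X ∈ multiloop σ ζ := by rwa [← descended_eq_multiloop hζ hσ]
    exact ⟨⟨Kassel.mk X 0, (mem_descendedHat_iff hm hζ hσ hu _).2 ⟨hX', 0, map_zero _⟩⟩, rfl⟩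
  · intro x hx
    have hx' : Kassel.proj (x : Kassel k (Laurent k n) 𝔤) = 0 :=
      congrArg Subtype.val (LieHom.mem_ker.1 hx)
    refine (LieModule.mem_maxTrivSubmodule k _ _ x).2 fun y => Subtype.ext ?_
    exact (LieModule.mem_maxTrivSubmodule k _ _ _).1 (mem_center_of_proj_eq_zero hx') y

theorem isUniversalCentralExtension_descendedProj (hm : ∀ j, 0 < m j)
    (hζ : ∀ j, IsPrimitiveRoot (ζ j) (m j)) (hσ : ∀ j x, (σ j)^[m j] x = x)
    (hcomm : ∀ i j x, σ i (σ j x) = σ j (σ i x))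
    (hu : ∀ a, IsLift (constLoop (multiloopTwist σ a)) (uhat a)) :
    IsUniversalCentralExtension.{w}
      (descendedProj (galLaurent ζ) (multiloopTwist σ) uhat hu) := by
  refine isUniversalCentralExtension_of_forall_cocycle
    (isCentralExtension_descendedProj hm hζ hσ hu) (isPerfect_descendedHat hm hζ hσ hcomm hu) ?_
  -- `L_u` and `L` are equal subalgebras of `𝔤_S`, but not definitionally
  have key (L : LieSubalgebra k (Laurent k n ⊗[k] 𝔤)) (hL : L = multiloop σ ζ)
      (ψ : L →ₗ[k] L →ₗ[k] k) (hψ : ∀ X, ψ X X = 0)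
      (hψ' : ∀ X Y Z, ψ X ⁅Y, Z⁆ = ψ ⁅X, Y⁆ Z + ψ Y ⁅X, Z⁆) :
      ∃ F : Kassel k (Laurent k n) 𝔤 →ₗ[k] k, ∀ x y (hx : Kassel.proj x ∈ L)
        (hy : Kassel.proj y ∈ L), F ⁅x, y⁆ = ψ ⟨_, hx⟩ ⟨_, hy⟩ := by
    subst hL
    exact exists_functional_of_cocycle hm hζ hσ hcomm ψ hψ hψ'
  intro ψ hψ hψ'
  obtain ⟨F, hF⟩ := key _ (descended_eq_multiloop hζ hσ) ψ hψ hψ'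
  exact ⟨F ∘ₗ (descendedHat (galLaurent ζ) uhat).toSubmodule.subtype,
    fun x y => hF x y (descendedProj (galLaurent ζ) (multiloopTwist σ) uhat hu x).2
      (descendedProj (galLaurent ζ) (multiloopTwist σ) uhat hu y).2⟩

/-- The centre of `L_û` projects to zero, since the multiloop algebra has trivial centre. -/
theorem proj_eq_zero_of_mem_center (hm : ∀ j, 0 < m j)
    (hζ : ∀ j, IsPrimitiveRoot (ζ j) (m j)) (hσ : ∀ j x, (σ j)^[m j] x = x)
    (hcomm : ∀ i j x, σ i (σ j x) = σ j (σ i x))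
    (hu : ∀ a, IsLift (constLoop (multiloopTwist σ a)) (uhat a))
    {x : descendedHat (galLaurent ζ) uhat} (hx : x ∈ LieAlgebra.center k _) :
    Kassel.proj (x : Kassel k (Laurent k n) 𝔤) = 0 := by
  let := eigenGradedLieAlgebra hm hζ hσ hcomm
  refine loop_ext fun i => ?_
  rw [map_zero]
  refine eq_zero_of_forall_lie_eq_zero k fun y => ?_
  rw [← lie_skew, neg_eq_zero]
  induction y using graded_induction (eigenGrading m ζ σ) with
  | zero => rw [zero_lie]
  | add y y' h h' => rw [add_lie, h, h', add_zero]
  | mem a y hy =>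
    obtain ⟨j, rfl⟩ := gradeClass_surjective a
    rw [eigenGrading_gradeClass hm hζ] at hy
    let y' : descendedHat (galLaurent ζ) uhat := ⟨Kassel.mk (mon k j ⊗ₜ y) 0,
      (mem_descendedHat_iff hm hζ hσ hu _).2 ⟨mon_tmul_mem_multiloop hy, 0, map_zero _⟩⟩
    have h := (LieModule.mem_maxTrivSubmodule k _ _ x).1 hx y'
    have h' : ⁅mon k j ⊗ₜ[k] y, Kassel.proj (x : Kassel k (Laurent k n) 𝔤)⁆ = 0 := by
      have e := congrArg (fun z : descendedHat (galLaurent ζ) uhat =>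
        Kassel.proj (z : Kassel k (Laurent k n) 𝔤)) h
      exact (LieHom.map_lie Kassel.proj (y' : Kassel k (Laurent k n) 𝔤) x).symm.trans e
    rw [← loopCoeff_lie_mon, h', map_zero]

theorem exists_equiv_center_descendedHat (hm : ∀ j, 0 < m j)
    (hζ : ∀ j, IsPrimitiveRoot (ζ j) (m j)) (hσ : ∀ j x, (σ j)^[m j] x = x)
    (hcomm : ∀ i j x, σ i (σ j x) = σ j (σ i x))
    (hu : ∀ a, IsLift (constLoop (multiloopTwist σ a)) (uhat a)) :
    ∃ e : OmegaModExact k (Laurent k n) ≃ₗ[k]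
        LieAlgebra.center k (descendedHat (galLaurent ζ) uhat),
      ∀ ω, ((e ω : descendedHat (galLaurent ζ) uhat) : Kassel k (Laurent k n) 𝔤) =
        Kassel.mk 0 (mapOmegaModExact (laurentIncl k m) ω) := by
  have hH := mem_descendedHat_iff hm hζ hσ hu
  let f : OmegaModExact k (Laurent k n) →ₗ[k] descendedHat (galLaurent ζ) uhat :=
    LinearMap.codRestrict (descendedHat (galLaurent ζ) uhat).toSubmodule
      (kasselInr k (Laurent k n) 𝔤 ∘ₗ mapOmegaModExact (laurentIncl k m))
      fun ω => (hH _).2 ⟨zero_mem _, ω, rfl⟩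
  let g : OmegaModExact k (Laurent k n) →ₗ[k]
      LieAlgebra.center k (descendedHat (galLaurent ζ) uhat) :=
    LinearMap.codRestrict (LieAlgebra.center k (descendedHat (galLaurent ζ) uhat)).toSubmodule f
      fun ω => (isCentralExtension_descendedProj hm hζ hσ hu).ker_le_center
        (LieHom.mem_ker.2 (Subtype.ext rfl))
  refine ⟨LinearEquiv.ofBijective g ⟨fun ω ω' h => ?_, fun x => ?_⟩, fun ω => rfl⟩
  · refine mapOmegaModExact_laurentIncl_injective hm ?_
    have h' : f ω = f ω' := congrArg Subtype.val h
    exact congrArg (fun z : descendedHat (galLaurent ζ) uhat =>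
      Kassel.snd (z : Kassel k (Laurent k n) 𝔤)) h'
  · obtain ⟨-, ω, hω⟩ := (hH _).1 (x : descendedHat (galLaurent ζ) uhat).2
    refine ⟨ω, Subtype.ext (Subtype.ext ?_)⟩
    change Kassel.mk 0 (mapOmegaModExact (laurentIncl k m) ω) = _
    rw [hω, ← proj_eq_zero_of_mem_center hm hζ hσ hcomm hu x.2]
    rfl

end Hat

end MultiloopUCE

end

open MultiloopUCE in
theorem corollary3p8 {k : Type*} [Field k] [IsAlgClosed k] [CharZero k]
    {𝔤 : Type*} [LieRing 𝔤] [LieAlgebra k 𝔤] [FiniteDimensional k 𝔤] [LieAlgebra.IsSimple k 𝔤]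
    {n : ℕ} (m : Fin n → ℕ) (hm : ∀ j, 0 < m j)
    (ζ : Fin n → kˣ) (hζ : ∀ j, IsPrimitiveRoot (ζ j) (m j))
    (σ : Fin n → (𝔤 ≃ₗ⁅k⁆ 𝔤)) (hσ : ∀ j x, (σ j)^[m j] x = x)
    (hcomm : ∀ i j x, σ i (σ j x) = σ j (σ i x))
    {ι M N : Type*} [Finite ι] [AddCommGroup M] [Module k M] [AddCommGroup N] [Module k N]
    (P : RootPairing ι k M N) [P.IsRootSystem] [P.IsCrystallographic] [P.IsIrreducible]
    (gr : M → (Fin n → ℤ) → Submodule k (multiloop σ ζ))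
    (hgr : IsLieTorus P gr) (hnat : ∀ i, ⨆ α, gr α i = multiloopGrade σ ζ i) :
    descended (galLaurent (m := m) ζ) (multiloopTwist σ) = multiloop σ ζ ∧
    (∀ a : ∀ j, ZMod (m j), ∃! θ : Kassel k (Laurent k n) 𝔤 ≃ₗ⁅k⁆ Kassel k (Laurent k n) 𝔤,
      IsLift (constLoop (multiloopTwist σ a)) θ) ∧
    ∀ (uhat : (∀ j, ZMod (m j)) → (Kassel k (Laurent k n) 𝔤 ≃ₗ⁅k⁆ Kassel k (Laurent k n) 𝔤))
      (hu : ∀ a, IsLift (constLoop (multiloopTwist σ a)) (uhat a)),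
      IsUniversalCentralExtension.{w}
        (descendedProj (galLaurent ζ) (multiloopTwist σ) uhat hu) ∧
      ∃ e : OmegaModExact k (Laurent k n) ≃ₗ[k]
          LieAlgebra.center k (descendedHat (galLaurent ζ) uhat),
        ∀ ω, ((e ω : descendedHat (galLaurent ζ) uhat) : Kassel k (Laurent k n) 𝔤) =
          Kassel.mk 0 (mapOmegaModExact (laurentIncl k m) ω) := by
  refine ⟨descended_eq_multiloop hζ hσ, fun a => ?_, fun uhat hu =>
    ⟨isUniversalCentralExtension_descendedProj hm hζ hσ hcomm hu,
      exists_equiv_center_descendedHat hm hζ hσ hcomm hu⟩⟩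
  obtain ⟨v, hv⟩ := exists_equiv_multiloopTwist σ a
  rw [hv]
  exact ⟨kasselLift v, isLift_kasselLift v, fun θ hθ => hθ.unique (isLift_kasselLift v)⟩
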